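/- Let $N\ge 1$, $k\in\mathbb Z$, $\Gamma=\Gamma_0(N)$, and let $\psi$ be a Dirichlet character modulo $N$ with $\psi(-1)=(-1)^k$. For $\gamma\in\Gamma$ with lower-right entry $d$ put $\psi(\gamma)=\psi(d)$, and for $g=\begin{pmatrix}*&*\\c&d\end{pmatrix}\in SL_2(\mathbb R)$ put $j(g,z)=\frac{cz+d}{|cz+d|}$. A scaling matrix for a cusp $\mathfrak a$ is $\sigma\in SL_2(\mathbb R)$ with $\sigma\infty=\mathfrak a$ and $\sigma^{-1}\Gamma_{\mathfrak a}\sigma=\{\pm\begin{pmatrix}1&b\\0&1\end{pmatrix}:b\in\mathbb Z\}$, where $\Gamma_{\mathfrak a}$ is the stabilizer of $\mathfrak a$ in $\Gamma$; the cusp is singular for $\psi$ if $\psi(\sigma\begin{pmatrix}1&1\\0&1\end{pmatrix}\sigma^{-1})=1$. For a singular cusp and $\operatorname{Re}(s)>1$ let $$E_{\mathfrak a}(z,s,\psi)=\sum_{\gamma\in\Gamma_{\mathfrak a}\backslash\Gamma}\overline{\psi}(\gamma)\,j(\sigma^{-1}\gamma,z)^{-k}\,(\operatorname{Im}\sigma^{-1}\gamma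 z)^s .$$ For Dirichlet characters $\chi_i$ modulo $q_i$ $(i=1,2)$ and $\operatorname{Re}(s)>1$ let $$E_{\chi_1,\chi_2}(z,s)=\frac12\sum_{(c,d)=1}\frac{(q_2y)^s\chi_1(c)\chi_2(d)}{|cq_2z+d|^{2s}}\Big(\frac{|cq_2z+d|}{cq_2z+d}\Big)^k,\qquad y=\operatorname{Im} z .$$ Theorem. Let $f\mid N$ and let $u$ be a nonzero integer coprime to $N$ such that the cusp $\frac1{uf}$ is singular for $\psi$. Let $E_{\frac1{uf}}$ be formed with a scaling matrix $\sigma$ which, if $k$ is odd, has positive upper-left entry (for odd $k$, replacing $\sigma$ by $-\sigma$ changes the sign of $E_{\mathfrak a}$). Put $N''=\frac{N/f}{(f,N/f)}$. Then for all $z$ in the upper half-plane and $\operatorname{Re}(s)>1$ the series above converge absolutely and $$E_{\frac{1}{uf}}(z,s,\psi)=\frac{1}{(fN'')^s}\frac{1}{\varphi((f,N/f))}\sum_{q_1\mid\frac Nf}\ \sum_{q_2\mid f}\ \sum_{\chi_1,\chi_2}\overline{\chi_1}(-u)\,\frac{L(2s,\chi_1\chi_2)}{L(2s,\chi_1\chi_2\chi_{0,N})}\sum_{\substack{a\mid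 f\\(a,q_2)=1}}\ \sum_{\substack{b\mid\frac Nf\\(b,q_1)=1}}\frac{\mu(a)\mu(b)\chi_1(b)\chi_2(a)}{(ab)^s}\,E_{\chi_1,\chi_2}\Big(\frac{bf}{aq_2}z,s\Big),$$ where $\chi_i$ runs over the primitive characters modulo $q_i$ such that $\chi_1\overline{\chi_2}\sim\psi$, i.e. $\chi_1\overline{\chi_2}$ and $\psi$ are induced by the same primitive character, and $\chi_{0,N}$ is the principal character modulo $N$. Moreover, for each $z$, the same identity holds between the meromorphic continuations in $s$ to $\mathbb C$ of the two sides: if $F$ is a meromorphic function on $\mathbb C$ extending $E_{\frac1{uf}}(z,\cdot,\psi)$, and each $E_{\chi_1,\chi_2}(w,\cdot)$ (for $\chi_1,\chi_2$ primitive with $\chi_1(-1)\chi_2(-1)=(-1)^k$ and $w$ in the upper half-plane) is replaced by a meromorphic function on $\mathbb C$ extending it, the identity holds outside a closed discrete set of $s$. -/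

import Mathlib

open UpperHalfPlane
open scoped MatrixGroups

noncomputable section

namespace EisensteinCusp

/-! ### Eisenstein series attached to cusps -/

/-- The upper triangular unipotent matrix with upper right entry `x`. -/
def unipotent (x : ℝ) : SL(2, ℝ) :=
  ⟨!![1, x; 0, 1], by simp [Matrix.det_fin_two_of]⟩

/-- An element of `Γ₀(N)` viewed in `SL(2, ℝ)`. -/
def toSLReal {N : ℕ} (γ : CongruenceSubgroup.Gamma0 N) : SL(2, ℝ) :=
  Matrix.SpecialLinearGroup.map (Int.castRingHom ℝ) (γ : SL(2, ℤ))

/-- `ψ(γ) = ψ(d)` where `d` is the lower-right entry of `γ ∈ Γ₀(N)`. -/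
def nebentypus {N : ℕ} (ψ : DirichletCharacter ℂ N) (γ : CongruenceSubgroup.Gamma0 N) : ℂ :=
  ψ ((((γ : SL(2, ℤ)) 1 1 : ℤ)) : ZMod N)

/-- `j(g, z) = (cz + d) / |cz + d|`. -/
def jFactor (g : SL(2, ℝ)) (z : ℍ) : ℂ :=
  ((g 1 0 : ℂ) * (z : ℂ) + (g 1 1 : ℂ)) / (‖(g 1 0 : ℂ) * (z : ℂ) + (g 1 1 : ℂ)‖ : ℂ)

/-- The stabilizer `Γ_𝔞` of the cusp `𝔞 ∈ ℙ¹(ℝ)` in `Γ = Γ₀(N)`. -/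
def cuspStabilizer (N : ℕ) (a : OnePoint ℝ) : Subgroup (CongruenceSubgroup.Gamma0 N) :=
  (MulAction.stabilizer (GL (Fin 2) ℝ) a).comap
    ((Matrix.SpecialLinearGroup.mapGL ℝ).comp (CongruenceSubgroup.Gamma0 N).subtype)

/-- `σ` is a scaling matrix for the cusp `𝔞` of `Γ₀(N)`: `σ ∞ = 𝔞` and
`σ⁻¹ Γ_𝔞 σ = {± (1 b; 0 1) : b ∈ ℤ}`. -/
def IsScalingMatrix (N : ℕ) (a : OnePoint ℝ) (σ : SL(2, ℝ)) : Prop :=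
  (σ : GL (Fin 2) ℝ) • (OnePoint.infty : OnePoint ℝ) = a ∧
  {g : SL(2, ℝ) | ∃ γ ∈ cuspStabilizer N a, g = σ⁻¹ * toSLReal γ * σ} =
    {g : SL(2, ℝ) | ∃ b : ℤ, g = unipotent b ∨ g = -unipotent b}

/-- The cusp `𝔞` of `Γ₀(N)` is singular for `ψ`: `ψ(τ_𝔞) = 1`, where
`τ_𝔞 = σ_𝔞 (1 1; 0 1) σ_𝔞⁻¹ ∈ Γ₀(N)` (which does not depend on the scaling matrix `σ_𝔞`). -/
def IsSingular {N : ℕ} (ψ : DirichletCharacter ℂ N) (a : OnePoint ℝ) : Prop :=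
  ∃ σ : SL(2, ℝ), IsScalingMatrix N a σ ∧
    ∃ τ : CongruenceSubgroup.Gamma0 N,
      toSLReal τ = σ * unipotent 1 * σ⁻¹ ∧ nebentypus ψ τ = 1

/-- The summand `ψ̄(γ) j(σ⁻¹γ, z)^{-k} (Im σ⁻¹γz)^s`. -/
def cuspTerm {N : ℕ} (ψ : DirichletCharacter ℂ N) (k : ℤ) (σ : SL(2, ℝ)) (z : ℍ) (s : ℂ)
    (γ : CongruenceSubgroup.Gamma0 N) : ℂ :=
  starRingEnd ℂ (nebentypus ψ γ) * jFactor (σ⁻¹ * toSLReal γ) z ^ (-k) *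
    ((((σ⁻¹ * toSLReal γ) • z).im : ℝ) : ℂ) ^ s

/-- The set `Γ_𝔞 \ Γ` of cosets `Γ_𝔞 γ`, for `Γ = Γ₀(N)`. -/
abbrev CuspCosets (N : ℕ) (a : OnePoint ℝ) : Type :=
  Quotient (QuotientGroup.rightRel (cuspStabilizer N a))

/-- The Eisenstein series `E_𝔞(z, s, ψ)` of weight `k` (for `Re s > 1`), formed with the scaling
matrix `σ` of `𝔞`. When `𝔞` is singular for `ψ` and `ψ(-1) = (-1)^k`, the summand depends on
the coset only, so that the choice of representatives (`Quotient.out`) is immaterial. -/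
def cuspEisenstein {N : ℕ} (ψ : DirichletCharacter ℂ N) (k : ℤ) (a : OnePoint ℝ)
    (σ : SL(2, ℝ)) (z : ℍ) (s : ℂ) : ℂ :=
  ∑' x : CuspCosets N a, cuspTerm ψ k σ z s x.out

/-! ### Eisenstein series attached to characters -/

/-- The summand of `E_{χ₁,χ₂}(z, s)`, without the factor `1/2`. -/
def charTerm {q₁ q₂ : ℕ} (χ₁ : DirichletCharacter ℂ q₁) (χ₂ : DirichletCharacter ℂ q₂) (k : ℤ)
    (z s : ℂ) (p : {p : ℤ × ℤ // IsCoprime p.1 p.2}) : ℂ :=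
  ((q₂ * z.im : ℝ) : ℂ) ^ s * χ₁ (p.1.1 : ZMod q₁) * χ₂ (p.1.2 : ZMod q₂) /
      (‖(p.1.1 : ℂ) * q₂ * z + p.1.2‖ : ℂ) ^ (2 * s) *
    ((‖(p.1.1 : ℂ) * q₂ * z + p.1.2‖ : ℂ) / ((p.1.1 : ℂ) * q₂ * z + p.1.2)) ^ k

/-- The Eisenstein series `E_{χ₁,χ₂}(z, s)` of weight `k` (for `Im z > 0`, `Re s > 1`). -/
def charEisenstein {q₁ q₂ : ℕ} (χ₁ : DirichletCharacter ℂ q₁) (χ₂ : DirichletCharacter ℂ q₂)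
    (k : ℤ) (z s : ℂ) : ℂ :=
  (1 / 2) * ∑' p : {p : ℤ × ℤ // IsCoprime p.1 p.2}, charTerm χ₁ χ₂ k z s p

/-! ### The finite combination -/

/-- `χ ∼ ψ`: both characters are induced by the same primitive character. -/
def SamePrimitive {m n : ℕ} (χ : DirichletCharacter ℂ m) (ψ : DirichletCharacter ℂ n) : Prop :=
  ∃ (d : ℕ) (hm : d ∣ m) (hn : d ∣ n) (θ : DirichletCharacter ℂ d), θ.IsPrimitive ∧
    χ = DirichletCharacter.changeLevel hm θ ∧ ψ = DirichletCharacter.changeLevel hn θ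

/-- The Dirichlet `L`-function (analytically continued) of a character of positive modulus;
the value for modulus `0` is irrelevant. -/
def dirichletL {q : ℕ} (χ : DirichletCharacter ℂ q) (s : ℂ) : ℂ :=
  if h : q = 0 then 0 else
    haveI : NeZero q := ⟨h⟩
    DirichletCharacter.LFunction χ s

/-- With `N'' = (N/f) / (f, N/f)`, the combination
`(f N'')^{-s} / φ((f, N/f)) ∑_{q₁ ∣ N/f} ∑_{q₂ ∣ f} ∑_{χ₁, χ₂} χ̄₁(-u)
  L(2s, χ₁χ₂) / L(2s, χ₁χ₂χ_{0,N}) ∑_{a ∣ f, (a,q₂)=1} ∑_{b ∣ N/f, (b,q₁)=1}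
  μ(a) μ(b) χ₁(b) χ₂(a) (ab)^{-s} E_{χ₁,χ₂}((bf/(aq₂)) z, s)`
over primitive `χᵢ` modulo `qᵢ` with `χ₁ χ̄₂ ∼ ψ`, for a family `E` of functions
`E_{χ₁,χ₂}(z, s)`. The sum over the characters is finite, as the moduli are positive. -/
def charCombination {N : ℕ} (ψ : DirichletCharacter ℂ N) (f : ℕ) (u : ℤ)
    (E : ∀ q₁ q₂ : ℕ, DirichletCharacter ℂ q₁ → DirichletCharacter ℂ q₂ → ℂ → ℂ → ℂ)
    (z s : ℂ) : ℂ :=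
  1 / (((f * (N / f / Nat.gcd f (N / f)) : ℕ) : ℂ) ^ s) *
    (1 / (Nat.totient (Nat.gcd f (N / f)) : ℂ)) *
  ∑ q₁ ∈ (N / f).divisors, ∑ q₂ ∈ f.divisors,
    ∑ᶠ (χ₁ : DirichletCharacter ℂ q₁) (χ₂ : DirichletCharacter ℂ q₂)
      (_ : χ₁.IsPrimitive ∧ χ₂.IsPrimitive ∧ SamePrimitive (χ₁.mul (star χ₂)) ψ),
      starRingEnd ℂ (χ₁ (-(u : ZMod q₁))) *
      (dirichletL (χ₁.mul χ₂) (2 * s) /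
        dirichletL ((χ₁.mul χ₂).mul (1 : DirichletCharacter ℂ N)) (2 * s)) *
      ∑ a ∈ f.divisors with a.Coprime q₂, ∑ b ∈ (N / f).divisors with b.Coprime q₁,
        ((ArithmeticFunction.moebius a : ℂ) * (ArithmeticFunction.moebius b : ℂ) *
            χ₁ (b : ZMod q₁) * χ₂ (a : ZMod q₂)) / ((a * b : ℕ) : ℂ) ^ s *
          E q₁ q₂ χ₁ χ₂ (((b * f : ℕ) : ℂ) / ((a * q₂ : ℕ) : ℂ) * z) s

end EisensteinCusp

end

/-!
The lower row of `(1 0; uf 1)⁻¹ γ`, for `γ ∈ Γ₀(N)`, has the form `(fc, d)` with `(c, d)` coprime.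
A scaling matrix of the cusp `1 / (uf)` has first column `(a, ufa)` with `a² = N''`
(`scaling_apply_zero_zero_sq`), so the summand of the cusp series at `γ` is, up to the factor
`(f N'')^s`, the conjugate of `ψ(γ)` times `(fy)^s |cfz + d|^{-2s} (|cfz + d| / (cfz + d))^k`
(`cuspTerm_eq`). Cosets correspond to pairs `±(c, d)` (`mul_inv_mem_cuspStabilizer_iff`), and the
coprime pairs that occur are those for which some invertible residue class `e` modulo `N` satisfies
`ce ≡ -u` modulo `N / f` and `e ≡ d` modulo `f`; for singular cusps `ψ(γ) = ψ(e)`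
(`rowPair_modEq`, `exists_rowPair_eq`).

Singularity of the cusp says that `ψ` is trivial on the classes that are `1` modulo both `f` and
`N / f` (`IsSingular.apply_eq_one`), so `ψ(e)` depends on `(c, d)` only. By orthogonality
(`sum_quotientPairs`, `sum_quotientPairs_eq_conj`), the function of `(c, d)` which is the conjugate
of `ψ(e)` when `e` exists and `0` otherwise is `φ((f, N/f))⁻¹ ∑ X̄₁(-u) X₁(c) X₂(d)`, the sum being
over the characters `X₁` modulo `N / f` and `X₂` modulo `f` with `X₁ X̄₂ = ψ`. This writes the cusp
series as a combination of series of imprimitive characters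
(`cuspEisenstein_eq_sum_quotientPairs`).

The series of imprimitive characters reduce to those of the primitive characters inducing them:
summing over all pairs instead of coprime ones multiplies a series by an `L`-value
(`tsum_latticeTerm_eq`), and in the full lattice sum Möbius inversion replaces an induced character
by the one inducing it (`charEisenstein_changeLevel`). Sorting the `Xᵢ` by conductor gives the
identity for `Re s > 1` (`charCombination_eq`), and the identity theorem for meromorphic functions
extends it (`eventuallyEq_codiscrete_of_eq_on_halfPlane`).
-/

noncomputable section

namespace EisensteinCusp

/-! ### Sums over the lattice -/

/-- The function `w ↦ |w|^{-2s} (|w| / w)^k`, the weight `k` building block of all the series.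
For `s ≠ 0` its value at `0` is `0`, by the convention for division by zero, so that lattice sums
may run over all pairs of integers. -/
def weightKernel (k : ℤ) (s w : ℂ) : ℂ :=
  1 / (‖w‖ : ℂ) ^ (2 * s) * ((‖w‖ : ℂ) / w) ^ k

/-- The summand `χ₁(c) χ₂(d) |cx + d|^{-2s} (|cx + d| / (cx + d))^k` at `p = (c, d)`. -/
def latticeTerm {q₁ q₂ : ℕ} (χ₁ : DirichletCharacter ℂ q₁) (χ₂ : DirichletCharacter ℂ q₂) (k : ℤ)
    (x s : ℂ) (p : ℤ × ℤ) : ℂ :=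
  χ₁ (p.1 : ZMod q₁) * χ₂ (p.2 : ZMod q₂) * weightKernel k s ((p.1 : ℂ) * x + p.2)

lemma weightKernel_zero (k : ℤ) {s : ℂ} (hs : s ≠ 0) : weightKernel k s 0 = 0 := by
  simp [weightKernel, Complex.zero_cpow, hs]

lemma weightKernel_ofReal_mul (k : ℤ) (s w : ℂ) {t : ℝ} (ht : 0 < t) :
    weightKernel k s (t * w) = (t : ℂ) ^ (-(2 * s)) * weightKernel k s w := by
  have ht' : (t : ℂ) ≠ 0 := by exact_mod_cast ht.ne'
  have h1 : ‖(t : ℂ) * w‖ = t * ‖w‖ := by simp [abs_of_pos ht]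
  rw [weightKernel, weightKernel, h1, Complex.ofReal_mul,
    Complex.mul_cpow_ofReal_nonneg ht.le (norm_nonneg w), mul_div_mul_left _ _ ht', Complex.cpow_neg]
  field_simp

lemma weightKernel_neg (k : ℤ) (s w : ℂ) :
    weightKernel k s (-w) = (-1) ^ k * weightKernel k s w := by
  rw [weightKernel, weightKernel, norm_neg, div_neg, ← neg_one_mul, mul_zpow]
  ring

lemma norm_weightKernel_le (k : ℤ) {s : ℂ} (hs : 1 < s.re) (w : ℂ) :
    ‖weightKernel k s w‖ ≤ ‖w‖ ^ (-(2 * s.re)) := by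
  rcases eq_or_ne w 0 with rfl | hw
  · rw [weightKernel_zero k (by rintro rfl; simp at hs; linarith)]
    simp only [norm_zero]; positivity
  · have hw' : 0 < ‖w‖ := norm_pos_iff.mpr hw
    rw [weightKernel, norm_mul, norm_div, norm_zpow, norm_div, norm_one,
      Complex.norm_cpow_eq_rpow_re_of_pos hw', Complex.norm_real, norm_norm, div_self hw'.ne',
      one_zpow, mul_one, Real.rpow_neg hw'.le, one_div]
    simp

lemma summable_weightKernel (k : ℤ) (x : ℍ) {s : ℂ} (hs : 1 < s.re) :
    Summable fun p : ℤ × ℤ => ‖weightKernel k s ((p.1 : ℂ) * x + p.2)‖ := by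
  have h1 : Summable fun v : Fin 2 → ℤ => EisensteinSeries.r x ^ (-(2 * s.re)) *
      ‖v‖ ^ (-(2 * s.re)) :=
    (EisensteinSeries.summable_one_div_norm_rpow (by linarith)).mul_left _
  have h2 : Summable fun v : Fin 2 → ℤ => ‖weightKernel k s ((v 0 : ℂ) * x + v 1)‖ :=
    h1.of_nonneg_of_le (fun _ => norm_nonneg _) fun v =>
      (norm_weightKernel_le k hs _).trans
        (EisensteinSeries.summand_bound x (by linarith) v)
  exact (finTwoArrowEquiv ℤ).summable_iff.mp h2

lemma summable_norm_latticeTerm {q₁ q₂ : ℕ} (χ₁ : DirichletCharacter ℂ q₁)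
    (χ₂ : DirichletCharacter ℂ q₂) (k : ℤ) (x : ℍ) {s : ℂ} (hs : 1 < s.re) :
    Summable fun p => ‖latticeTerm χ₁ χ₂ k x s p‖ := by
  refine (summable_weightKernel k x hs).of_nonneg_of_le (fun _ => norm_nonneg _) fun p => ?_
  rw [latticeTerm, norm_mul, norm_mul]
  refine mul_le_of_le_one_left (norm_nonneg _) ?_
  exact mul_le_one₀ (DirichletCharacter.norm_le_one _ _) (norm_nonneg _)
    (DirichletCharacter.norm_le_one _ _)

lemma summable_latticeTerm {q₁ q₂ : ℕ} (χ₁ : DirichletCharacter ℂ q₁)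
    (χ₂ : DirichletCharacter ℂ q₂) (k : ℤ) (x : ℍ) {s : ℂ} (hs : 1 < s.re) :
    Summable (latticeTerm χ₁ χ₂ k x s) :=
  (summable_norm_latticeTerm χ₁ χ₂ k x hs).of_norm

lemma charTerm_eq {q₁ q₂ : ℕ} (χ₁ : DirichletCharacter ℂ q₁) (χ₂ : DirichletCharacter ℂ q₂)
    (k : ℤ) (z s : ℂ) (p : {p : ℤ × ℤ // IsCoprime p.1 p.2}) :
    charTerm χ₁ χ₂ k z s p = ((q₂ * z.im : ℝ) : ℂ) ^ s * latticeTerm χ₁ χ₂ k (q₂ * z) s p := by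
  rw [charTerm, latticeTerm, weightKernel, ← mul_assoc ((p : ℤ × ℤ).1 : ℂ)]
  ring

/-- The point `r z` of the upper half-plane, for real `r > 0`. -/
def posScale (r : ℝ) (hr : 0 < r) (z : ℍ) : ℍ :=
  ⟨r * z, by simpa using mul_pos hr z.im_pos⟩

lemma summable_charTerm {q₁ q₂ : ℕ} (χ₁ : DirichletCharacter ℂ q₁)
    (χ₂ : DirichletCharacter ℂ q₂) (hq₂ : 0 < q₂) (k : ℤ) (z : ℍ) {s : ℂ} (hs : 1 < s.re) :
    Summable (charTerm χ₁ χ₂ k z s) := by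
  have h := summable_latticeTerm χ₁ χ₂ k (posScale q₂ (by exact_mod_cast hq₂) z) hs
  have h' := (h.comp_injective Subtype.val_injective (i := fun p :
    {p : ℤ × ℤ // IsCoprime p.1 p.2} => (p : ℤ × ℤ))).mul_left (((q₂ * (z : ℂ).im : ℝ) : ℂ) ^ s)
  refine h'.congr fun p => ?_
  rw [charTerm_eq]
  simp [posScale]

/-! ### Removing the coprimality condition -/

/-- The product of two characters of different moduli, at all integers: on both sides the value is
`0` unless `n` is coprime to both moduli. -/
lemma mul_apply_intCast {q₁ q₂ : ℕ} (χ₁ : DirichletCharacter ℂ q₁)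
    (χ₂ : DirichletCharacter ℂ q₂) (n : ℤ) :
    χ₁.mul χ₂ (n : ZMod (Nat.lcm q₁ q₂)) = χ₁ (n : ZMod q₁) * χ₂ (n : ZMod q₂) := by
  rw [DirichletCharacter.mul, MulChar.mul_apply]
  by_cases h : IsCoprime n ((Nat.lcm q₁ q₂ : ℕ) : ℤ)
  · rw [DirichletCharacter.changeLevel_eq_cast_of_dvd' _ _ h,
      DirichletCharacter.changeLevel_eq_cast_of_dvd' _ _ h]
  · rw [(DirichletCharacter.apply_eq_zero_iff _ n).mpr h, zero_mul]
    by_contra h0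
    obtain ⟨h1, h2⟩ := mul_ne_zero_iff.mp (Ne.symm h0)
    rw [DirichletCharacter.apply_ne_zero_iff] at h1 h2
    refine h ((h1.mul_right h2).of_isCoprime_of_dvd_right ?_)
    exact_mod_cast Nat.lcm_dvd (Nat.dvd_mul_right _ _) (Nat.dvd_mul_left _ _)

/-- In the half-plane of convergence `dirichletL` is the Dirichlet series, indexed by `n ≥ 1`. -/
lemma tsum_pnat_eq_dirichletL {q : ℕ} (hq : 0 < q) (χ : DirichletCharacter ℂ q) {s : ℂ}
    (hs : 1 < s.re) :
    ∑' n : ℕ+, χ ((n : ℕ) : ZMod q) * ((n : ℕ) : ℂ) ^ (-s) = dirichletL χ s := by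
  have : NeZero q := ⟨hq.ne'⟩
  rw [dirichletL, dif_neg hq.ne', DirichletCharacter.LFunction_eq_LSeries χ hs, LSeries]
  rw [← PNat.coe_injective.tsum_eq (f := LSeries.term (fun n => χ n) s)]
  · refine tsum_congr fun n => ?_
    rw [LSeries.term_of_ne_zero n.ne_zero, Complex.cpow_neg, div_eq_mul_inv]
  · intro n hn
    rcases Nat.eq_zero_or_pos n with rfl | h
    · simp at hn
    · exact ⟨⟨n, h⟩, rfl⟩

lemma summable_pnat_cpow {q : ℕ} (χ : DirichletCharacter ℂ q) {s : ℂ} (hs : 1 < s.re) :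
    Summable fun n : ℕ+ => ‖χ ((n : ℕ) : ZMod q) * ((n : ℕ) : ℂ) ^ (-s)‖ := by
  have h := (Real.summable_nat_rpow.mpr (show -s.re < -1 by linarith)).comp_injective
    PNat.coe_injective
  refine h.of_nonneg_of_le (fun _ => norm_nonneg _) fun n => ?_
  rw [norm_mul]
  refine (mul_le_of_le_one_left (norm_nonneg _) (DirichletCharacter.norm_le_one _ _)).trans ?_
  rw [Complex.norm_natCast_cpow_of_pos n.pos]
  simp

/-- A nonzero pair is in a unique way a positive multiple of a coprime pair. -/
lemma mul_coprime_injective : Function.Injective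
    fun x : ℕ+ × {p : ℤ × ℤ // IsCoprime p.1 p.2} =>
      (((x.1 : ℕ) : ℤ) * x.2.1.1, ((x.1 : ℕ) : ℤ) * x.2.1.2) := by
  have key (n : ℕ+) (p : {p : ℤ × ℤ // IsCoprime p.1 p.2}) :
      Int.gcd (((n : ℕ) : ℤ) * p.1.1) (((n : ℕ) : ℤ) * p.1.2) = (n : ℕ) := by
    rw [Int.gcd_mul_left, Int.isCoprime_iff_gcd_eq_one.mp p.2]
    simp
  rintro ⟨n, p⟩ ⟨m, r⟩ h
  simp only [Prod.mk.injEq] at h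
  have hnm : n = m := by
    have := key n p
    rw [h.1, h.2, key] at this
    exact PNat.coe_injective this.symm
  subst hnm
  have hn : ((n : ℕ) : ℤ) ≠ 0 := by exact_mod_cast n.ne_zero
  have : p = r := Subtype.ext (Prod.ext (mul_left_cancel₀ hn h.1) (mul_left_cancel₀ hn h.2))
  rw [this]

/-- Sorting the nonzero pairs by their greatest common divisor; the pair `(0, 0)` contributes
nothing. -/
lemma tsum_latticeTerm_eq {q₁ q₂ : ℕ} (hq₁ : 0 < q₁) (hq₂ : 0 < q₂)
    (χ₁ : DirichletCharacter ℂ q₁)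
    (χ₂ : DirichletCharacter ℂ q₂) (k : ℤ) (x : ℍ) {s : ℂ} (hs : 1 < s.re) :
    ∑' p, latticeTerm χ₁ χ₂ k x s p = dirichletL (χ₁.mul χ₂) (2 * s) *
      ∑' p : {p : ℤ × ℤ // IsCoprime p.1 p.2}, latticeTerm χ₁ χ₂ k x s p := by
  have hs0 : s ≠ 0 := by rintro rfl; simp at hs; linarith
  have hs2 : 1 < (2 * s).re := by simp; linarith
  have hsum := (summable_norm_latticeTerm χ₁ χ₂ k x hs).comp_injective
    (i := fun p : {p : ℤ × ℤ // IsCoprime p.1 p.2} => (p : ℤ × ℤ)) Subtype.val_injective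
  rw [← tsum_pnat_eq_dirichletL (Nat.lcm_pos hq₁ hq₂) (χ₁.mul χ₂) hs2,
    tsum_mul_tsum_of_summable_norm (summable_pnat_cpow (χ₁.mul χ₂) hs2) hsum,
    ← mul_coprime_injective.tsum_eq (f := latticeTerm χ₁ χ₂ k x s)]
  · refine tsum_congr fun y => ?_
    have hy : (0 : ℝ) < ((y.1 : ℕ) : ℝ) := by exact_mod_cast y.1.pos
    have h1 := mul_apply_intCast χ₁ χ₂ ((y.1 : ℕ) : ℤ)
    have h2 : ((((y.1 : ℕ) : ℤ) * y.2.1.1 : ℤ) : ℂ) * x + ((((y.1 : ℕ) : ℤ) * y.2.1.2 : ℤ) : ℂ) =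
        (((y.1 : ℕ) : ℝ) : ℂ) * ((y.2.1.1 : ℂ) * x + y.2.1.2) := by
      push_cast; ring
    simp only [latticeTerm]
    rw [h2, weightKernel_ofReal_mul k s _ hy]
    push_cast at h1 ⊢
    rw [h1, map_mul, map_mul]
    ring
  · rintro ⟨c, d⟩ hp
    have h0 : 0 < Int.gcd c d := by
      rw [Int.gcd_pos_iff]
      by_contra! h
      refine hp ?_
      simp [latticeTerm, h.1, h.2, weightKernel_zero k hs0]
    obtain ⟨c', d', h1, hc, hd⟩ := Int.exists_gcd_one h0
    refine ⟨(⟨Int.gcd c d, h0⟩, ⟨(c', d'), Int.isCoprime_iff_gcd_eq_one.mpr h1⟩), ?_⟩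
    simp only [PNat.mk_coe, Prod.mk.injEq]
    exact ⟨by rw [mul_comm]; exact hc.symm, by rw [mul_comm]; exact hd.symm⟩

/-! ### Imprimitive characters -/

lemma sum_moebius_dvd {M : ℕ} (hM : 0 < M) (c : ℤ) :
    ∑ b ∈ M.divisors, (if (b : ℤ) ∣ c then (ArithmeticFunction.moebius b : ℂ) else 0) =
      if IsCoprime c (M : ℤ) then 1 else 0 := by
  have h1 : M.divisors.filter (fun b : ℕ => (b : ℤ) ∣ c) = (Nat.gcd c.natAbs M).divisors := by
    ext b
    simp only [Finset.mem_filter, Nat.mem_divisors, Nat.dvd_gcd_iff, Int.natCast_dvd]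
    have := (Nat.gcd_pos_of_pos_right c.natAbs hM).ne'
    simp only [ne_eq, hM.ne', this, not_false_eq_true, and_true]
    exact and_comm
  have h2 := congrArg (fun F : ArithmeticFunction ℤ => F (Nat.gcd c.natAbs M))
    ArithmeticFunction.moebius_mul_coe_zeta
  simp only [ArithmeticFunction.coe_mul_zeta_apply, ArithmeticFunction.one_apply] at h2
  rw [← Finset.sum_filter, h1]
  simp only [Int.isCoprime_iff_gcd_eq_one, Int.gcd, Int.natAbs_natCast]
  exact_mod_cast h2

/-- An imprimitive character in terms of a character inducing it, at all integers. -/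
lemma changeLevel_apply_intCast {q M : ℕ} (h : q ∣ M) (χ : DirichletCharacter ℂ q) (c : ℤ) :
    DirichletCharacter.changeLevel h χ (c : ZMod M) =
      if IsCoprime c (M : ℤ) then χ (c : ZMod q) else 0 := by
  split_ifs with hc
  · exact DirichletCharacter.changeLevel_eq_cast_of_dvd' _ _ hc
  · exact (DirichletCharacter.apply_eq_zero_iff _ c).mpr hc

/-- An imprimitive character by Möbius inversion over the common divisors of `c` and the
modulus. -/
lemma changeLevel_eq_sum_moebius {q M : ℕ} (hM : 0 < M) (h : q ∣ M)
    (χ : DirichletCharacter ℂ q) (c : ℤ) :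
    DirichletCharacter.changeLevel h χ (c : ZMod M) =
      ∑ b ∈ M.divisors, (if (b : ℤ) ∣ c then (ArithmeticFunction.moebius b : ℂ) else 0) *
        χ (c : ZMod q) := by
  rw [← Finset.sum_mul, sum_moebius_dvd hM, changeLevel_apply_intCast]
  split_ifs <;> simp

/-- The part of the lattice sum over the pairs in `bℤ × aℤ`. -/
lemma tsum_ite_dvd_latticeTerm {q₁ q₂ : ℕ} (χ₁ : DirichletCharacter ℂ q₁)
    (χ₂ : DirichletCharacter ℂ q₂) (k : ℤ) (x s : ℂ) {a b : ℕ} (ha : 0 < a) (hb : 0 < b) :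
    ∑' p : ℤ × ℤ, (if (b : ℤ) ∣ p.1 ∧ (a : ℤ) ∣ p.2 then latticeTerm χ₁ χ₂ k x s p else 0) =
      χ₁ (b : ZMod q₁) * χ₂ (a : ZMod q₂) * (a : ℂ) ^ (-(2 * s)) *
        ∑' p, latticeTerm χ₁ χ₂ k ((b : ℂ) / a * x) s p := by
  have ha' : (a : ℤ) ≠ 0 := by exact_mod_cast ha.ne'
  have hb' : (b : ℤ) ≠ 0 := by exact_mod_cast hb.ne'
  have haC : (a : ℂ) ≠ 0 := by exact_mod_cast ha.ne'
  have hinj : Function.Injective fun p : ℤ × ℤ => ((b : ℤ) * p.1, (a : ℤ) * p.2) := by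
    rintro ⟨c, d⟩ ⟨c', d'⟩ h
    simp only [Prod.mk.injEq, mul_eq_mul_left_iff, ha', hb', or_false] at h
    exact Prod.ext h.1 h.2
  rw [← hinj.tsum_eq, ← tsum_mul_left]
  · refine tsum_congr fun p => ?_
    rw [if_pos ⟨dvd_mul_right _ _, dvd_mul_right _ _⟩]
    have h : (((b : ℤ) * p.1 : ℤ) : ℂ) * x + (((a : ℤ) * p.2 : ℤ) : ℂ) =
        ((a : ℝ) : ℂ) * ((p.1 : ℂ) * ((b : ℂ) / a * x) + p.2) := by
      push_cast; field_simp
    simp only [latticeTerm]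
    rw [h, weightKernel_ofReal_mul _ _ _ (by exact_mod_cast ha)]
    push_cast
    rw [map_mul, map_mul]
    ring
  · rintro ⟨c, d⟩ hp
    have h : (b : ℤ) ∣ c ∧ (a : ℤ) ∣ d := by
      by_contra h
      exact hp (if_neg h)
    obtain ⟨⟨c', rfl⟩, ⟨d', rfl⟩⟩ := h
    exact ⟨(c', d'), rfl⟩

lemma tsum_latticeTerm_changeLevel {q₁ q₂ M₁ M₂ : ℕ} (hM₁ : 0 < M₁) (hM₂ : 0 < M₂)
    (h₁ : q₁ ∣ M₁) (h₂ : q₂ ∣ M₂) (χ₁ : DirichletCharacter ℂ q₁)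
    (χ₂ : DirichletCharacter ℂ q₂) (k : ℤ) (x : ℍ) {s : ℂ} (hs : 1 < s.re) :
    ∑' p, latticeTerm (DirichletCharacter.changeLevel h₁ χ₁)
        (DirichletCharacter.changeLevel h₂ χ₂) k x s p =
      ∑ a ∈ M₂.divisors, ∑ b ∈ M₁.divisors,
        (ArithmeticFunction.moebius a : ℂ) * (ArithmeticFunction.moebius b : ℂ) *
          (χ₁ (b : ZMod q₁) * χ₂ (a : ZMod q₂) * (a : ℂ) ^ (-(2 * s)) *
            ∑' p, latticeTerm χ₁ χ₂ k ((b : ℂ) / a * x) s p) := by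
  have hterm (p : ℤ × ℤ) : latticeTerm (DirichletCharacter.changeLevel h₁ χ₁)
      (DirichletCharacter.changeLevel h₂ χ₂) k x s p =
      ∑ a ∈ M₂.divisors, ∑ b ∈ M₁.divisors,
        (ArithmeticFunction.moebius a : ℂ) * (ArithmeticFunction.moebius b : ℂ) *
          (if (b : ℤ) ∣ p.1 ∧ (a : ℤ) ∣ p.2 then latticeTerm χ₁ χ₂ k x s p else 0) := by
    rw [latticeTerm, changeLevel_eq_sum_moebius hM₁, changeLevel_eq_sum_moebius hM₂, mul_comm
      (∑ b ∈ M₁.divisors, _), Finset.sum_mul_sum, Finset.sum_mul]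
    refine Finset.sum_congr rfl fun a _ => ?_
    rw [Finset.sum_mul]
    refine Finset.sum_congr rfl fun b _ => ?_
    by_cases hb : (b : ℤ) ∣ p.1 <;> by_cases ha : (a : ℤ) ∣ p.2 <;> simp [ha, hb, latticeTerm]
    ring
  have hsum (a b : ℕ) : Summable fun p : ℤ × ℤ =>
      (ArithmeticFunction.moebius a : ℂ) * (ArithmeticFunction.moebius b : ℂ) *
      (if (b : ℤ) ∣ p.1 ∧ (a : ℤ) ∣ p.2 then latticeTerm χ₁ χ₂ k x s p else 0) := by
    refine Summable.mul_left _ (Summable.of_norm_bounded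
      (summable_norm_latticeTerm χ₁ χ₂ k x hs) fun p => ?_)
    split_ifs <;> simp
  rw [tsum_congr hterm, Summable.tsum_finsetSum fun a _ => summable_sum fun b _ => hsum a b]
  refine Finset.sum_congr rfl fun a ha => ?_
  rw [Summable.tsum_finsetSum fun b _ => hsum a b]
  refine Finset.sum_congr rfl fun b hb => ?_
  rw [tsum_mul_left, tsum_ite_dvd_latticeTerm _ _ _ _ _ (Nat.pos_of_mem_divisors ha)
    (Nat.pos_of_mem_divisors hb)]

lemma charEisenstein_eq {q₁ q₂ : ℕ} (χ₁ : DirichletCharacter ℂ q₁)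
    (χ₂ : DirichletCharacter ℂ q₂) (k : ℤ) (z s : ℂ) :
    charEisenstein χ₁ χ₂ k z s = 1 / 2 * (((q₂ * z.im : ℝ) : ℂ) ^ s *
      ∑' p : {p : ℤ × ℤ // IsCoprime p.1 p.2}, latticeTerm χ₁ χ₂ k (q₂ * z) s p) := by
  simp only [charEisenstein, charTerm_eq, tsum_mul_left]

lemma dirichletL_ne_zero {q : ℕ} (hq : 0 < q) (χ : DirichletCharacter ℂ q) {s : ℂ}
    (hs : 1 < s.re) : dirichletL χ s ≠ 0 := by
  have : NeZero q := ⟨hq.ne'⟩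
  rw [dirichletL, dif_neg hq.ne', DirichletCharacter.LFunction_eq_LSeries χ hs]
  exact DirichletCharacter.LSeries_ne_zero_of_one_lt_re χ hs

/-- The Eisenstein series of induced characters in terms of those of the inducing characters. -/
lemma charEisenstein_changeLevel {q₁ q₂ M₁ M₂ : ℕ} (hM₁ : 0 < M₁) (hM₂ : 0 < M₂)
    (h₁ : q₁ ∣ M₁) (h₂ : q₂ ∣ M₂) (χ₁ : DirichletCharacter ℂ q₁)
    (χ₂ : DirichletCharacter ℂ q₂) (k : ℤ) (z : ℍ) {s : ℂ} (hs : 1 < s.re) :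
    charEisenstein (DirichletCharacter.changeLevel h₁ χ₁)
        (DirichletCharacter.changeLevel h₂ χ₂) k z s =
      dirichletL (χ₁.mul χ₂) (2 * s) / dirichletL ((DirichletCharacter.changeLevel h₁ χ₁).mul
        (DirichletCharacter.changeLevel h₂ χ₂)) (2 * s) *
      ∑ a ∈ M₂.divisors, ∑ b ∈ M₁.divisors,
        ((ArithmeticFunction.moebius a : ℂ) * (ArithmeticFunction.moebius b : ℂ) *
            χ₁ (b : ZMod q₁) * χ₂ (a : ZMod q₂)) / ((a * b : ℕ) : ℂ) ^ s *
          charEisenstein χ₁ χ₂ k (((b * M₂ : ℕ) : ℂ) / ((a * q₂ : ℕ) : ℂ) * z) s := by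
  have hs2 : 1 < (2 * s).re := by simp; linarith
  have hq₁ := Nat.pos_of_dvd_of_pos h₁ hM₁
  have hq₂ := Nat.pos_of_dvd_of_pos h₂ hM₂
  have hL := dirichletL_ne_zero (Nat.lcm_pos hM₁ hM₂) ((DirichletCharacter.changeLevel h₁ χ₁).mul
        (DirichletCharacter.changeLevel h₂ χ₂)) hs2
  have hM₂' : (0 : ℝ) < M₂ := by exact_mod_cast hM₂
  have hz := z.im_pos
  have hX := tsum_latticeTerm_changeLevel hM₁ hM₂ h₁ h₂ χ₁ χ₂ k (posScale M₂ hM₂' z) hs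
  rw [tsum_latticeTerm_eq hM₁ hM₂ _ _ k (posScale M₂ hM₂' z) hs] at hX
  have hcoe : ((posScale M₂ hM₂' z : ℍ) : ℂ) = M₂ * z := by simp [posScale]
  rw [hcoe] at hX
  rw [charEisenstein_eq, div_mul_eq_mul_div (dirichletL _ _), eq_div_iff hL]
  rw [show ∀ A B C D : ℂ, A * (B * C) * D = A * B * (D * C) by intros; ring, hX, Finset.mul_sum,
    Finset.mul_sum]
  refine Finset.sum_congr rfl fun a ha => ?_
  rw [Finset.mul_sum, Finset.mul_sum]
  refine Finset.sum_congr rfl fun b hb => ?_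
  have ha0 : (0 : ℝ) < a := by exact_mod_cast Nat.pos_of_mem_divisors ha
  have hb0 : (0 : ℝ) < b := by exact_mod_cast Nat.pos_of_mem_divisors hb
  have haC : (a : ℂ) ≠ 0 := by exact_mod_cast ha0.ne'
  have hqR : (0 : ℝ) < q₂ := by exact_mod_cast hq₂
  have hqC : (q₂ : ℂ) ≠ 0 := by exact_mod_cast hqR.ne'
  have hcoe' : ((posScale (b / a * M₂) (by positivity) z : ℍ) : ℂ) = (b : ℂ) / a * (M₂ * z) := by
    simp only [posScale]; push_cast; ring
  rw [← hcoe', tsum_latticeTerm_eq hq₁ hq₂ χ₁ χ₂ k _ hs, hcoe', charEisenstein_eq]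
  have e1 : (q₂ : ℂ) * (((b * M₂ : ℕ) : ℂ) / ((a * q₂ : ℕ) : ℂ) * z) = (b : ℂ) / a * (M₂ * z) := by
    push_cast; field_simp
  have e2 : (q₂ * (((b * M₂ : ℕ) : ℂ) / ((a * q₂ : ℕ) : ℂ) * (z : ℂ)).im : ℝ) =
      b * ((a : ℝ)⁻¹ * (M₂ * z.im)) := by
    rw [← Complex.ofReal_natCast (b * M₂), ← Complex.ofReal_natCast (a * q₂), ← Complex.ofReal_div,
      Complex.im_ofReal_mul]
    push_cast; field_simp; simp
  have e3 : ((b * ((a : ℝ)⁻¹ * (M₂ * z.im)) : ℝ) : ℂ) ^ s =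
      (b : ℂ) ^ s * (((a : ℂ) ^ s)⁻¹ * ((M₂ * z.im : ℝ) : ℂ) ^ s) := by
    rw [Complex.ofReal_mul, Complex.mul_cpow_ofReal_nonneg hb0.le (by positivity),
      Complex.ofReal_mul (a : ℝ)⁻¹, Complex.mul_cpow_ofReal_nonneg (by positivity) (by positivity),
      Complex.ofReal_inv, Complex.inv_cpow _ _ (by
        rw [Complex.arg_ofReal_of_nonneg ha0.le]; exact Real.pi_pos.ne)]
    simp
  rw [e1, e2, e3, Nat.cast_mul, Complex.natCast_mul_natCast_cpow, two_mul, neg_add,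
    Complex.cpow_add _ _ haC, Complex.cpow_neg]
  have hbs : (b : ℂ) ^ s ≠ 0 := by
    rw [Complex.cpow_ne_zero_iff]; left; exact_mod_cast hb0.ne'
  have has : (a : ℂ) ^ s ≠ 0 := by
    rw [Complex.cpow_ne_zero_iff]; left; exact haC
  rw [UpperHalfPlane.coe_im]
  field_simp

/-! ### Pairs of characters with prescribed quotient -/

open scoped Classical in
/-- The pairs of characters `X₁` modulo `M₁` and `X₂` modulo `M₂` for which `X₁ X̄₂`, as a
character modulo the common multiple `N`, is `ψ`. -/
def quotientPairs {M₁ M₂ N : ℕ} [NeZero M₁] [NeZero M₂] (h₁ : M₁ ∣ N) (h₂ : M₂ ∣ N)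
    (ψ : DirichletCharacter ℂ N) :
    Finset (DirichletCharacter ℂ M₁ × DirichletCharacter ℂ M₂) :=
  {X | DirichletCharacter.changeLevel h₁ X.1 * (DirichletCharacter.changeLevel h₂ X.2)⁻¹ = ψ}

lemma mem_quotientPairs {M₁ M₂ N : ℕ} [NeZero M₁] [NeZero M₂] {h₁ : M₁ ∣ N} {h₂ : M₂ ∣ N}
    {ψ : DirichletCharacter ℂ N} {X : DirichletCharacter ℂ M₁ × DirichletCharacter ℂ M₂} :
    X ∈ quotientPairs h₁ h₂ ψ ↔
      DirichletCharacter.changeLevel h₁ X.1 * (DirichletCharacter.changeLevel h₂ X.2)⁻¹ = ψ := by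
  simp [quotientPairs]

lemma conj_apply_isUnit {M : ℕ} [NeZero M] (X : DirichletCharacter ℂ M) {a : ZMod M}
    (ha : IsUnit a) : starRingEnd ℂ (X a) = X a⁻¹ := by
  have h1 : X a⁻¹ * X a = 1 := by rw [← map_mul, ZMod.inv_mul_of_unit a ha, map_one]
  obtain ⟨v, rfl⟩ := ha
  have h2 := Complex.inv_eq_conj (X.unit_norm_eq_one v)
  rw [← h2, eq_inv_of_mul_eq_one_left h1]

open scoped Classical in
lemma sum_units_apply {N : ℕ} [NeZero N] (χ : DirichletCharacter ℂ N) :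
    ∑ e : (ZMod N)ˣ, χ (e : ZMod N) = if χ = 1 then (N.totient : ℂ) else 0 := by
  have h := sum_hom_units (χ.toMonoidHom.comp (Units.coeHom (ZMod N)))
  have h2 : χ.toMonoidHom.comp (Units.coeHom (ZMod N)) = 1 ↔ χ = 1 := by
    constructor
    · intro h3
      ext e
      simpa using! DFunLike.congr_fun h3 e
    · rintro rfl
      ext e
      simp
  simp only [h2, ZMod.card_units_eq_totient] at h
  exact_mod_cast h

open scoped Classical in
/-- Orthogonality, in the group of characters and in `(ℤ/N)ˣ`, turns the sum over the pairs into
a sum over residue classes modulo `N`. -/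
lemma sum_quotientPairs {M₁ M₂ N : ℕ} [NeZero M₁] [NeZero M₂] [NeZero N] (h₁ : M₁ ∣ N)
    (h₂ : M₂ ∣ N) (ψ : DirichletCharacter ℂ N) {v : ZMod M₁} (hv : IsUnit v)
    (c : ZMod M₁) (d : ZMod M₂) :
    (N.totient : ℂ) * ∑ X ∈ quotientPairs h₁ h₂ ψ, starRingEnd ℂ (X.1 v) * X.1 c * X.2 d =
      (M₁.totient * M₂.totient : ℂ) * ∑ e : (ZMod N)ˣ,
        if v = c * (ZMod.unitsMap h₁ e : (ZMod M₁)ˣ) ∧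
          ((ZMod.unitsMap h₂ e : (ZMod M₂)ˣ) : ZMod M₂) = d
        then starRingEnd ℂ (ψ e) else 0 := by
  have hdet (X : DirichletCharacter ℂ M₁ × DirichletCharacter ℂ M₂) :
      (if X ∈ quotientPairs h₁ h₂ ψ then (N.totient : ℂ) else 0) =
      ∑ e : (ZMod N)ˣ, X.1 (ZMod.unitsMap h₁ e : (ZMod M₁)ˣ) *
        X.2 ((ZMod.unitsMap h₂ e : (ZMod M₂)ˣ) : ZMod M₂)⁻¹ * starRingEnd ℂ (ψ e) := by
    have := sum_units_apply (DirichletCharacter.changeLevel h₁ X.1 *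
      (DirichletCharacter.changeLevel h₂ X.2)⁻¹ * ψ⁻¹)
    simp only [mul_inv_eq_one (b := ψ), ← mem_quotientPairs] at this
    rw [← this]
    refine Finset.sum_congr rfl fun e _ => ?_
    rw [MulChar.mul_apply, MulChar.mul_apply, ← MulChar.star_eq_inv, ← MulChar.star_eq_inv,
      MulChar.star_apply, MulChar.star_apply, DirichletCharacter.changeLevel_eq_cast_of_dvd,
      DirichletCharacter.changeLevel_eq_cast_of_dvd, ← conj_apply_isUnit _ (Units.isUnit _)]
    simp [ZMod.unitsMap_val]
  calc (N.totient : ℂ) * ∑ X ∈ quotientPairs h₁ h₂ ψ, starRingEnd ℂ (X.1 v) * X.1 c * X.2 d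
      = ∑ X : DirichletCharacter ℂ M₁ × DirichletCharacter ℂ M₂,
          (if X ∈ quotientPairs h₁ h₂ ψ then (N.totient : ℂ) else 0) *
            (starRingEnd ℂ (X.1 v) * X.1 c * X.2 d) := by
        simp only [ite_mul, zero_mul]
        rw [← Finset.sum_filter, Finset.filter_mem_eq_inter, Finset.univ_inter, Finset.mul_sum]
    _ = ∑ e : (ZMod N)ˣ, starRingEnd ℂ (ψ e) *
          ((∑ X₁ : DirichletCharacter ℂ M₁, X₁ v⁻¹ * X₁ (c * (ZMod.unitsMap h₁ e : (ZMod M₁)ˣ))) *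
          ∑ X₂ : DirichletCharacter ℂ M₂,
            X₂ ((ZMod.unitsMap h₂ e : (ZMod M₂)ˣ) : ZMod M₂)⁻¹ * X₂ d) := by
        simp only [hdet, Finset.sum_mul]
        rw [Finset.sum_comm]
        refine Finset.sum_congr rfl fun e _ => ?_
        rw [Fintype.sum_prod_type, Finset.mul_sum]
        refine Finset.sum_congr rfl fun X₁ _ => ?_
        rw [Finset.mul_sum, Finset.mul_sum]
        refine Finset.sum_congr rfl fun X₂ _ => ?_
        rw [conj_apply_isUnit _ hv, map_mul]
        ring
    _ = _ := by
        rw [Finset.mul_sum]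
        refine Finset.sum_congr rfl fun e _ => ?_
        rw [DirichletCharacter.sum_char_inv_mul_char_eq ℂ hv,
          DirichletCharacter.sum_char_inv_mul_char_eq ℂ (Units.isUnit _)]
        by_cases ha : v = c * (ZMod.unitsMap h₁ e : (ZMod M₁)ˣ) <;>
          by_cases hb : ((ZMod.unitsMap h₂ e : (ZMod M₂)ˣ) : ZMod M₂) = d <;> simp [ha, hb]
        ring

/-- If `ψ(1 + uL) = 1` with `u` invertible and `N ∣ L²`, then `ψ` is trivial on the residue
classes that are `1` modulo `L`: they are the powers of `1 + uL`. -/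
lemma apply_eq_one_of_modEq {N : ℕ} [NeZero N] (ψ : DirichletCharacter ℂ N) {L u : ℤ}
    (hu : IsCoprime u (N : ℤ)) (hL : (N : ℤ) ∣ L ^ 2) (h : ψ ((1 + u * L : ℤ) : ZMod N) = 1) {e : ℤ}
    (he : L ∣ e - 1) : ψ (e : ZMod N) = 1 := by
  obtain ⟨t, ht⟩ := he
  have hL0 : (L : ZMod N) * L = 0 := by
    have := (ZMod.intCast_zmod_eq_zero_iff_dvd (L ^ 2) N).mpr hL
    rwa [pow_two, Int.cast_mul] at this
  have hpow (n : ℕ) : ((1 + u * L : ℤ) : ZMod N) ^ n = 1 + n * u * L := by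
    induction n with
    | zero => simp
    | succ n ih =>
      rw [pow_succ, ih]
      push_cast
      linear_combination (n * u * u : ZMod N) * hL0
  have huu : (u : ZMod N)⁻¹ * u = 1 :=
    ZMod.inv_mul_of_unit _ ((ZMod.coe_int_isUnit_iff_isCoprime u N).mpr hu.symm)
  have he' : (e : ZMod N) = ((1 + u * L : ℤ) : ZMod N) ^ ((t : ZMod N) * (u : ZMod N)⁻¹).val := by
    rw [hpow, ZMod.natCast_zmod_val, show e = 1 + L * t by linarith]
    push_cast
    linear_combination (-(L : ZMod N) * t) * huu
  rw [he', map_pow, h, one_pow]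

/-- The number of classes in `(ℤ/N)ˣ` that are `1` modulo both `M₁` and `M₂` is
`φ(N) / φ(lcm M₁ M₂)`, which for `N = M₁M₂` equals the greatest common divisor. -/
lemma card_unitsMap_fiber {M₁ M₂ N : ℕ} [NeZero N] (hN : M₁ * M₂ = N) (h₁ : M₁ ∣ N)
    (h₂ : M₂ ∣ N) :
    Nat.card {e : (ZMod N)ˣ // ZMod.unitsMap h₁ e = 1 ∧ ZMod.unitsMap h₂ e = 1} =
      Nat.gcd M₁ M₂ := by
  have hN0 : 0 < N := Nat.pos_of_ne_zero (NeZero.ne N)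
  have hL : Nat.lcm M₁ M₂ ∣ N := Nat.lcm_dvd h₁ h₂
  have hL0 : 0 < Nat.lcm M₁ M₂ := Nat.pos_of_dvd_of_pos hL hN0
  have : NeZero (Nat.lcm M₁ M₂) := ⟨hL0.ne'⟩
  have hset : Nat.card {e : (ZMod N)ˣ // ZMod.unitsMap h₁ e = 1 ∧ ZMod.unitsMap h₂ e = 1} =
      Nat.card (ZMod.unitsMap hL).ker := by
    refine Nat.card_congr (Equiv.subtypeEquivRight fun e => ?_)
    obtain ⟨n, hn⟩ := ZMod.intCast_surjective (e : ZMod N)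
    rw [MonoidHom.mem_ker]
    simp only [Units.ext_iff, ZMod.unitsMap_val, ← hn, Units.val_one]
    have hone (m : ℕ) : (n : ZMod m) = 1 ↔ m ∣ (1 - n).natAbs := by
      rw [← Int.natCast_dvd, ← ZMod.intCast_eq_intCast_iff_dvd_sub, Int.cast_one]
    rw [ZMod.cast_intCast h₁, ZMod.cast_intCast h₂, ZMod.cast_intCast hL, hone, hone, hone,
      Nat.lcm_dvd_iff]
  have hcard : Nat.totient (Nat.lcm M₁ M₂) * Nat.card (ZMod.unitsMap hL).ker = N.totient := by
    have h := Subgroup.card_eq_card_quotient_mul_card_subgroup (ZMod.unitsMap hL).ker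
    rw [Nat.card_congr (QuotientGroup.quotientKerEquivOfSurjective _
      (ZMod.unitsMap_surjective hL)).toEquiv, Nat.card_eq_fintype_card, Nat.card_eq_fintype_card,
      ZMod.card_units_eq_totient, ZMod.card_units_eq_totient] at h
    exact h.symm
  have hg : 0 < Nat.gcd M₁ M₂ := Nat.gcd_pos_of_pos_left _ (Nat.pos_of_dvd_of_pos h₁ hN0)
  have hphi := Nat.totient_gcd_mul_totient_mul (Nat.gcd M₁ M₂) (Nat.lcm M₁ M₂)
  rw [Nat.gcd_eq_left ((Nat.gcd_dvd_left _ _).trans (Nat.dvd_lcm_left _ _)), Nat.gcd_mul_lcm, hN,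
    mul_assoc] at hphi
  have hphi' := Nat.eq_of_mul_eq_mul_left (Nat.totient_pos.mpr hg) hphi
  rw [hset]
  exact Nat.eq_of_mul_eq_mul_left (Nat.totient_pos.mpr hL0) (hcard.trans hphi')

/-- If `ψ` is trivial on the classes that are `1` modulo both `M₁` and `M₂`, the sum over the pairs
recovers `ψ` from the residues of `e` modulo `M₁` and `M₂`. -/
lemma sum_quotientPairs_eq_conj {M₁ M₂ N : ℕ} [NeZero M₁] [NeZero M₂] [NeZero N]
    (hN : M₁ * M₂ = N) (h₁ : M₁ ∣ N) (h₂ : M₂ ∣ N) (ψ : DirichletCharacter ℂ N)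
    (hψ : ∀ e : (ZMod N)ˣ, ZMod.unitsMap h₁ e = 1 → ZMod.unitsMap h₂ e = 1 → ψ e = 1)
    {v : ZMod M₁} (hv : IsUnit v) (c : ZMod M₁) (d : ZMod M₂) (e : (ZMod N)ˣ)
    (hc : v = c * (ZMod.unitsMap h₁ e : (ZMod M₁)ˣ))
    (hd : ((ZMod.unitsMap h₂ e : (ZMod M₂)ˣ) : ZMod M₂) = d) :
    ∑ X ∈ quotientPairs h₁ h₂ ψ, starRingEnd ℂ (X.1 v) * X.1 c * X.2 d =
      (Nat.gcd M₁ M₂).totient * starRingEnd ℂ (ψ e) := by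
  classical
  have hφN : (N.totient : ℂ) ≠ 0 := by
    exact_mod_cast (Nat.totient_pos.mpr (Nat.pos_of_ne_zero (NeZero.ne N))).ne'
  have hcu : IsUnit c := isUnit_of_mul_isUnit_left (hc ▸ hv)
  refine mul_left_cancel₀ hφN ?_
  rw [sum_quotientPairs h₁ h₂ ψ hv]
  have hsum : (∑ e' : (ZMod N)ˣ, if v = c * (ZMod.unitsMap h₁ e' : (ZMod M₁)ˣ) ∧
          ((ZMod.unitsMap h₂ e' : (ZMod M₂)ˣ) : ZMod M₂) = d
        then starRingEnd ℂ (ψ e') else 0) = (Nat.gcd M₁ M₂ : ℂ) * starRingEnd ℂ (ψ e) := by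
    rw [← Equiv.sum_comp (Equiv.mulLeft e)]
    -- the admissible classes form the coset of `e` of the classes that are `1` modulo `M₁` and `M₂`
    have hP (e' : (ZMod N)ˣ) : (v = c * (ZMod.unitsMap h₁ (e * e') : (ZMod M₁)ˣ) ∧
          ((ZMod.unitsMap h₂ (e * e') : (ZMod M₂)ˣ) : ZMod M₂) = d) ↔
          (ZMod.unitsMap h₁ e' = 1 ∧ ZMod.unitsMap h₂ e' = 1) := by
      rw [hc, ← hd, hcu.mul_right_inj, Units.val_inj, Units.val_inj, map_mul, map_mul,
        left_eq_mul, mul_eq_left]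
    simp only [Equiv.coe_mulLeft, hP]
    rw [← card_unitsMap_fiber hN h₁ h₂, ← Finset.sum_filter, Nat.card_eq_fintype_card,
      Fintype.card_subtype, ← nsmul_eq_mul, ← Finset.sum_const]
    refine Finset.sum_congr rfl fun e' he' => ?_
    simp only [Finset.mem_filter, Finset.mem_univ, true_and] at he'
    rw [Units.val_mul, map_mul, hψ e' he'.1 he'.2, mul_one]
  have hphi := Nat.totient_gcd_mul_totient_mul M₁ M₂
  rw [hN] at hphi
  have hphi' : ((Nat.gcd M₁ M₂).totient * N.totient : ℂ) =
      M₁.totient * M₂.totient * Nat.gcd M₁ M₂ := by exact_mod_cast hphi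
  rw [hsum]
  linear_combination (-starRingEnd ℂ (ψ e)) * hphi'

/-- The sum over the pairs detects the compatibility of the two congruences for `e`. -/
lemma exists_of_sum_quotientPairs_ne_zero {M₁ M₂ N : ℕ} [NeZero M₁] [NeZero M₂] [NeZero N]
    (h₁ : M₁ ∣ N) (h₂ : M₂ ∣ N) (ψ : DirichletCharacter ℂ N)
    {v : ZMod M₁} (hv : IsUnit v) (c : ZMod M₁) (d : ZMod M₂)
    (h : ∑ X ∈ quotientPairs h₁ h₂ ψ, starRingEnd ℂ (X.1 v) * X.1 c * X.2 d ≠ 0) :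
    ∃ e : (ZMod N)ˣ, v = c * (ZMod.unitsMap h₁ e : (ZMod M₁)ˣ) ∧
      ((ZMod.unitsMap h₂ e : (ZMod M₂)ˣ) : ZMod M₂) = d := by
  classical
  by_contra! h0
  have hφN : (N.totient : ℂ) ≠ 0 := by
    exact_mod_cast (Nat.totient_pos.mpr (Nat.pos_of_ne_zero (NeZero.ne N))).ne'
  refine mul_ne_zero hφN h ?_
  rw [sum_quotientPairs h₁ h₂ ψ hv, Finset.sum_eq_zero, mul_zero]
  intro e _
  exact if_neg fun h1 => h0 e h1.1 h1.2

/-! ### The cusp `1 / (uf)` and its scaling matrices -/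

@[simp] lemma toSLReal_apply {N : ℕ} (γ : CongruenceSubgroup.Gamma0 N) (i j : Fin 2) :
    toSLReal γ i j = (((γ : SL(2, ℤ)) i j : ℤ) : ℝ) := rfl

lemma toSLReal_mul {N : ℕ} (γ δ : CongruenceSubgroup.Gamma0 N) :
    toSLReal (γ * δ) = toSLReal γ * toSLReal δ := by
  simp [toSLReal]

lemma toSLReal_inv {N : ℕ} (γ : CongruenceSubgroup.Gamma0 N) :
    toSLReal γ⁻¹ = (toSLReal γ)⁻¹ := by
  simp [toSLReal]

lemma det_eq {R : Type*} [CommRing R] (g : SL(2, R)) : g 0 0 * g 1 1 - g 0 1 * g 1 0 = 1 := by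
  have := g.det_coe
  rwa [Matrix.det_fin_two] at this

lemma inv_mul_apply_one_zero (σ g : SL(2, ℝ)) :
    (σ⁻¹ * g) 1 0 = σ 0 0 * g 1 0 - σ 1 0 * g 0 0 := by
  simp [Matrix.mul_apply, Fin.sum_univ_two, Matrix.SpecialLinearGroup.coe_inv,
    Matrix.adjugate_fin_two]
  ring

lemma inv_mul_apply_one_one (σ g : SL(2, ℝ)) :
    (σ⁻¹ * g) 1 1 = σ 0 0 * g 1 1 - σ 1 0 * g 0 1 := by
  simp [Matrix.mul_apply, Fin.sum_univ_two, Matrix.SpecialLinearGroup.coe_inv,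
    Matrix.adjugate_fin_two]
  ring

@[simp] lemma coe_unipotent (x : ℝ) :
    (unipotent x : Matrix (Fin 2) (Fin 2) ℝ) = !![1, x; 0, 1] := rfl

lemma unipotent_mul_apply_one (x : ℝ) (g : SL(2, ℝ)) (i : Fin 2) :
    (unipotent x * g) 1 i = g 1 i := by
  simp [Matrix.mul_apply, Fin.sum_univ_two]

lemma conj_unipotent (σ : SL(2, ℝ)) (r : ℝ) :
    ((σ * unipotent r * σ⁻¹ : SL(2, ℝ)) : Matrix (Fin 2) (Fin 2) ℝ) =
      !![1 - r * σ 0 0 * σ 1 0, r * σ 0 0 ^ 2; -r * σ 1 0 ^ 2, 1 + r * σ 0 0 * σ 1 0] := by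
  have h := det_eq σ
  ext i j
  fin_cases i <;> fin_cases j <;>
    simp [Matrix.mul_apply, Fin.sum_univ_two, Matrix.SpecialLinearGroup.coe_inv,
      Matrix.adjugate_fin_two]
  · linear_combination h
  · ring
  · ring
  · linear_combination h

/-- Conjugation by `σ` with `σ ∞ = 𝔞` carries the stabilizer of `𝔞` to upper triangular matrices. -/
lemma mem_cuspStabilizer_iff {N : ℕ} {a : OnePoint ℝ} {σ : SL(2, ℝ)}
    (hσ : (σ : GL (Fin 2) ℝ) • (OnePoint.infty : OnePoint ℝ) = a)
    (γ : CongruenceSubgroup.Gamma0 N) :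
    γ ∈ cuspStabilizer N a ↔ (σ⁻¹ * toSLReal γ * σ) 1 0 = 0 := by
  have h1 : Matrix.SpecialLinearGroup.mapGL ℝ (γ : SL(2, ℤ)) =
      Matrix.SpecialLinearGroup.toGL (toSLReal γ) := rfl
  rw [cuspStabilizer, Subgroup.mem_comap, MulAction.mem_stabilizer_iff, ← hσ]
  simp only [MonoidHom.comp_apply, Subgroup.coe_subtype, h1]
  rw [← inv_smul_eq_iff, ← mul_smul, ← mul_smul, ← map_inv, ← map_mul, ← map_mul,
    OnePoint.smul_infty_eq_self_iff]
  rfl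

/-- A scaling matrix of `1 / (uf)` has first column `(a, ufa)`. -/
lemma scaling_apply_one_zero {f : ℕ} (hf : 0 < f) {u : ℤ} (hu0 : u ≠ 0) {σ : SL(2, ℝ)}
    (hσ : (σ : GL (Fin 2) ℝ) • (OnePoint.infty : OnePoint ℝ) =
      (((1 / ((u : ℝ) * (f : ℝ)) : ℝ)) : OnePoint ℝ)) :
    σ 1 0 = u * f * σ 0 0 := by
  rw [OnePoint.smul_infty_eq_ite] at hσ
  split_ifs at hσ with h
  · exact absurd hσ (OnePoint.infty_ne_coe _)
  have h' := OnePoint.coe_injective hσ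
  have hne : (u : ℝ) * f ≠ 0 := mul_ne_zero (by exact_mod_cast hu0) (by exact_mod_cast hf.ne')
  have h2 : σ 0 0 / σ 1 0 = 1 / ((u : ℝ) * f) := h'
  have h3 : σ 1 0 ≠ 0 := h
  rw [div_eq_div_iff h3 hne] at h2
  linarith

lemma exists_gamma0 {N : ℕ} (A B C D : ℤ) (hdet : A * D - B * C = 1) (hC : (N : ℤ) ∣ C) :
    ∃ γ : CongruenceSubgroup.Gamma0 N, (γ : SL(2, ℤ)) 0 0 = A ∧ (γ : SL(2, ℤ)) 0 1 = B ∧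
      (γ : SL(2, ℤ)) 1 0 = C ∧ (γ : SL(2, ℤ)) 1 1 = D := by
  refine ⟨⟨⟨!![A, B; C, D], by rw [Matrix.det_fin_two_of]; exact hdet⟩, ?_⟩, ?_⟩
  · refine CongruenceSubgroup.Gamma0_mem.mpr ?_
    exact (ZMod.intCast_zmod_eq_zero_iff_dvd _ _).mpr hC
  · simp

lemma dvd_apply_one_zero {N : ℕ} (γ : CongruenceSubgroup.Gamma0 N) :
    (N : ℤ) ∣ (γ : SL(2, ℤ)) 1 0 :=
  (ZMod.intCast_zmod_eq_zero_iff_dvd _ _).mp (CongruenceSubgroup.Gamma0_mem.mp γ.2)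

/-- The width of the cusp `1 / (uf)` of `Γ₀(fM)` is `M / (f, M)`: it is the square of the upper
left entry of every scaling matrix. -/
lemma scaling_apply_zero_zero_sq {N f M : ℕ} (hf : 0 < f) (hM : 0 < M) (hN : f * M = N) {u : ℤ}
    (hu : IsCoprime u (N : ℤ)) (hu0 : u ≠ 0) {σ : SL(2, ℝ)}
    (hσ : IsScalingMatrix N (((1 / ((u : ℝ) * (f : ℝ)) : ℝ)) : OnePoint ℝ) σ) :
    σ 0 0 ^ 2 = ((M / Nat.gcd f M : ℕ) : ℝ) := by
  have h10 := scaling_apply_one_zero hf hu0 hσ.1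
  have hdet := det_eq σ
  have ha : σ 0 0 ≠ 0 := by
    intro h
    rw [h10, h] at hdet
    simp at hdet
  have hg : 0 < Nat.gcd f M := Nat.gcd_pos_of_pos_left _ hf
  obtain ⟨f', w, hcop, hf', hw⟩ := Nat.exists_coprime f M
  generalize hgdef : Nat.gcd f M = g at *
  have hwdiv : M / g = w := by rw [hw, Nat.mul_div_cancel _ hg]
  rw [hwdiv]
  have hw0 : 0 < w := by
    rcases Nat.eq_zero_or_pos w with h | h
    · simp [h] at hw; omega
    · exact h
  -- the matrix `τ₀ (1 w; 0 1) τ₀⁻¹` lies in the stabilizer, so `w / a²` is an integer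
  obtain ⟨γ, e00, e01, e10, e11⟩ := exists_gamma0 (N := N) (1 - u * f * w) w (-(u * f) ^ 2 * w)
    (1 + u * f * w) (by ring) (by
      refine ⟨-(u ^ 2 * f'), ?_⟩
      rw [← hN, hf', hw]; push_cast; ring)
  have hγ : toSLReal γ = σ * unipotent (w / σ 0 0 ^ 2) * σ⁻¹ := by
    refine Matrix.SpecialLinearGroup.ext _ _ fun i j => ?_
    rw [conj_unipotent, h10]
    fin_cases i <;> fin_cases j <;> simp [e00, e01, e10, e11] <;> field_simp
  have hconj : σ⁻¹ * toSLReal γ * σ = unipotent (w / σ 0 0 ^ 2) := by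
    rw [hγ]; group
  have hmem : γ ∈ cuspStabilizer N (((1 / ((u : ℝ) * (f : ℝ)) : ℝ)) : OnePoint ℝ) := by
    rw [mem_cuspStabilizer_iff hσ.1, hconj]
    simp
  have h1 : unipotent (w / σ 0 0 ^ 2) ∈ {g : SL(2, ℝ) | ∃ b : ℤ, g = unipotent b ∨
      g = -unipotent b} := by
    rw [← hσ.2]
    exact ⟨γ, hmem, hconj.symm⟩
  obtain ⟨b, hb⟩ := h1
  have hb' : (w : ℝ) / σ 0 0 ^ 2 = b := by
    rcases hb with hb | hb
    · have := congrArg (fun g : SL(2, ℝ) => g 0 1) hb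
      simpa using this
    · have := congrArg (fun g : SL(2, ℝ) => g 0 0) hb
      simp at this
      linarith
  -- conversely `σ (1 1; 0 1) σ⁻¹` is integral with lower left entry divisible by `N`
  have h2 : unipotent (1 : ℤ) ∈ {g : SL(2, ℝ) | ∃ γ ∈ cuspStabilizer N
      (((1 / ((u : ℝ) * (f : ℝ)) : ℝ)) : OnePoint ℝ), g = σ⁻¹ * toSLReal γ * σ} := by
    rw [hσ.2]
    exact ⟨1, Or.inl rfl⟩
  obtain ⟨δ, -, hδ⟩ := h2
  have hδ' : toSLReal δ = σ * unipotent (1 : ℤ) * σ⁻¹ := by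
    rw [hδ]; group
  have d01 := congrArg (fun g : SL(2, ℝ) => g 0 1) hδ'
  have d10 := congrArg (fun g : SL(2, ℝ) => g 1 0) hδ'
  simp only [conj_unipotent, toSLReal_apply] at d01 d10
  simp only [Int.cast_one, Matrix.of_apply, Matrix.cons_val', Matrix.cons_val_zero,
    Matrix.cons_val_one, Matrix.cons_val_fin_one, h10] at d01 d10
  obtain ⟨t, ht⟩ := dvd_apply_one_zero δ
  have hdvd : (w : ℤ) ∣ (δ : SL(2, ℤ)) 0 1 := by
    have hZ : (δ : SL(2, ℤ)) 1 0 = -(u * f) ^ 2 * (δ : SL(2, ℤ)) 0 1 := by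
      have : (((δ : SL(2, ℤ)) 1 0 : ℤ) : ℝ) = ((-(u * f) ^ 2 * (δ : SL(2, ℤ)) 0 1 : ℤ) : ℝ) := by
        push_cast; rw [d10, d01]; ring
      exact_mod_cast this
    have hwN : (w : ℤ) ∣ N := by rw [← hN, hw]; exact ⟨f * g, by push_cast; ring⟩
    have hc1 : IsCoprime (w : ℤ) u := (hu.of_isCoprime_of_dvd_right hwN).symm
    have hc2 : IsCoprime (w : ℤ) f' := Nat.isCoprime_iff_coprime.mpr hcop.symm
    refine (hc1.pow_right (n := 2)).dvd_of_dvd_mul_left (hc2.dvd_of_dvd_mul_left ⟨-t, ?_⟩)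
    have hfg : ((f : ℤ) * g) ≠ 0 := by
      have := Nat.mul_pos hf hg
      exact_mod_cast this.ne'
    refine mul_left_cancel₀ hfg ?_
    have hNZ : (N : ℤ) = f * (w * g) := by rw [← hN, hw]; push_cast; ring
    have hfZ : (f : ℤ) = f' * g := by exact_mod_cast hf'
    rw [hZ, hNZ] at ht
    linear_combination (-1 : ℤ) * ht - u ^ 2 * f * (δ : SL(2, ℤ)) 0 1 * hfZ
  obtain ⟨m, hm⟩ := hdvd
  have hw0' : (w : ℝ) ≠ 0 := by exact_mod_cast hw0.ne'
  have ha2 : σ 0 0 ^ 2 = w * m := by rw [← one_mul (σ 0 0 ^ 2), ← d01, hm]; push_cast; ring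
  have hbm : (m : ℝ) * b = 1 := by
    rw [← hb', ha2]
    have : (m : ℝ) ≠ 0 := by
      intro h; rw [h, mul_zero] at ha2; exact ha (pow_eq_zero_iff two_ne_zero |>.mp ha2)
    field_simp
  have hbm' : m * b = 1 := by exact_mod_cast hbm
  have hm0 : 0 ≤ m := by
    have h0 : 0 < (w : ℝ) * m := by rw [← ha2]; positivity
    have : (0 : ℝ) < m := (mul_pos_iff_of_pos_left (by positivity)).mp h0
    exact_mod_cast this.le
  rw [ha2, Int.eq_one_of_mul_eq_one_right hm0 hbm']
  simp

/-! ### Cosets and coprime pairs -/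

/-- For `γ = (A B; C D) ∈ Γ₀(N)` and `f ∣ N` the lower row of `(1 0; uf 1)⁻¹ γ` is `(fc, d)`
with `(c, d)` the pair given here. -/
def rowPair {N : ℕ} (f : ℕ) (u : ℤ) (γ : CongruenceSubgroup.Gamma0 N) : ℤ × ℤ :=
  ((γ : SL(2, ℤ)) 1 0 / f - u * (γ : SL(2, ℤ)) 0 0,
    (γ : SL(2, ℤ)) 1 1 - u * f * (γ : SL(2, ℤ)) 0 1)

lemma mul_rowPair_fst {N f : ℕ} (hf : f ∣ N) (u : ℤ) (γ : CongruenceSubgroup.Gamma0 N) :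
    f * (rowPair f u γ).1 = (γ : SL(2, ℤ)) 1 0 - u * f * (γ : SL(2, ℤ)) 0 0 := by
  have h : (f : ℤ) ∣ (γ : SL(2, ℤ)) 1 0 :=
    (Int.natCast_dvd_natCast.mpr hf).trans (dvd_apply_one_zero γ)
  simp only [rowPair, mul_sub, Int.mul_ediv_cancel' h]
  ring

lemma isCoprime_rowPair {N f : ℕ} (hf : f ∣ N) (u : ℤ) (γ : CongruenceSubgroup.Gamma0 N) :
    IsCoprime (rowPair f u γ).1 (rowPair f u γ).2 := by
  refine ⟨-f * (γ : SL(2, ℤ)) 0 1, (γ : SL(2, ℤ)) 0 0, ?_⟩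
  have h1 := mul_rowPair_fst hf u γ
  have h2 := det_eq (γ : SL(2, ℤ))
  simp only [rowPair] at h1 ⊢
  linear_combination h2 - (γ : SL(2, ℤ)) 0 1 * h1

/-- The lower row of `σ⁻¹ γ` for a matrix `σ` with first column `(a, ufa)`. -/
lemma lower_row_inv_mul {N f : ℕ} (hf : f ∣ N) (u : ℤ) {σ : SL(2, ℝ)}
    (h10 : σ 1 0 = u * f * σ 0 0) (γ : CongruenceSubgroup.Gamma0 N) :
    (σ⁻¹ * toSLReal γ) 1 0 = σ 0 0 * (f * (rowPair f u γ).1) ∧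
      (σ⁻¹ * toSLReal γ) 1 1 = σ 0 0 * (rowPair f u γ).2 := by
  have h1 : ((f * (rowPair f u γ).1 : ℤ) : ℝ) = _ := congrArg _ (mul_rowPair_fst hf u γ)
  rw [inv_mul_apply_one_zero, inv_mul_apply_one_one, h10]
  push_cast at h1
  rw [h1]
  simp only [toSLReal_apply, rowPair]
  push_cast
  constructor <;> ring

/-- Two elements of `Γ₀(N)` represent the same coset if and only if their pairs agree up to
sign. -/
lemma mul_inv_mem_cuspStabilizer_iff {N f : ℕ} [NeZero N] (hf : f ∣ N) {u : ℤ} (hu0 : u ≠ 0)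
    {σ : SL(2, ℝ)}
    (hσ : IsScalingMatrix N (((1 / ((u : ℝ) * (f : ℝ)) : ℝ)) : OnePoint ℝ) σ)
    (γ δ : CongruenceSubgroup.Gamma0 N) :
    γ * δ⁻¹ ∈ cuspStabilizer N (((1 / ((u : ℝ) * (f : ℝ)) : ℝ)) : OnePoint ℝ) ↔
      rowPair f u γ = rowPair f u δ ∨ rowPair f u γ = -rowPair f u δ := by
  have hf0 : 0 < f := Nat.pos_of_dvd_of_pos hf (Nat.pos_of_ne_zero (NeZero.ne N))
  have hfR : (f : ℝ) ≠ 0 := by exact_mod_cast hf0.ne'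
  have h10 := scaling_apply_one_zero hf0 hu0 hσ.1
  have ha : σ 0 0 ≠ 0 := by
    intro h
    have := det_eq σ
    rw [h10, h] at this
    simp at this
  obtain ⟨r1, r2⟩ := lower_row_inv_mul hf u h10 γ
  obtain ⟨s1, s2⟩ := lower_row_inv_mul hf u h10 δ
  have hfac : σ⁻¹ * toSLReal (γ * δ⁻¹) * σ = (σ⁻¹ * toSLReal γ) * (σ⁻¹ * toSLReal δ)⁻¹ := by
    rw [toSLReal_mul, toSLReal_inv]; group
  constructor
  · intro h
    have h1 : σ⁻¹ * toSLReal (γ * δ⁻¹) * σ ∈ {g : SL(2, ℝ) | ∃ b : ℤ, g = unipotent b ∨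
        g = -unipotent b} := by
      rw [← hσ.2]
      exact ⟨_, h, rfl⟩
    obtain ⟨b, hb⟩ := h1
    rw [hfac] at hb
    have hrow (ε : ℝ) (h0 : (σ⁻¹ * toSLReal γ) 1 0 = ε * (σ⁻¹ * toSLReal δ) 1 0)
        (h1 : (σ⁻¹ * toSLReal γ) 1 1 = ε * (σ⁻¹ * toSLReal δ) 1 1) :
        ((rowPair f u γ).1 : ℝ) = ε * (rowPair f u δ).1 ∧
          ((rowPair f u γ).2 : ℝ) = ε * (rowPair f u δ).2 := by
      rw [r1, s1] at h0
      rw [r2, s2] at h1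
      constructor
      · refine mul_left_cancel₀ (mul_ne_zero ha hfR) ?_
        linear_combination h0
      · refine mul_left_cancel₀ ha ?_
        linear_combination h1
    rcases hb with hb | hb
    · left
      have hb' := mul_inv_eq_iff_eq_mul.mp hb
      obtain ⟨e1, e2⟩ := hrow 1 (by rw [hb', unipotent_mul_apply_one, one_mul])
        (by rw [hb', unipotent_mul_apply_one, one_mul])
      rw [one_mul] at e1 e2
      exact Prod.ext (by exact_mod_cast e1) (by exact_mod_cast e2)
    · right
      have hb' := mul_inv_eq_iff_eq_mul.mp hb
      rw [neg_mul] at hb'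
      have hneg (i : Fin 2) : (σ⁻¹ * toSLReal γ) 1 i = -1 * (σ⁻¹ * toSLReal δ) 1 i := by
        rw [hb', Matrix.SpecialLinearGroup.coe_neg, Matrix.neg_apply, unipotent_mul_apply_one,
          neg_one_mul]
      obtain ⟨e1, e2⟩ := hrow (-1) (hneg 0) (hneg 1)
      rw [neg_one_mul] at e1 e2
      exact Prod.ext (by exact_mod_cast e1) (by exact_mod_cast e2)
  · intro h
    rw [mem_cuspStabilizer_iff hσ.1, hfac]
    have hent (g h : SL(2, ℝ)) : (g * h⁻¹) 1 0 = g 1 0 * h 1 1 - g 1 1 * h 1 0 := by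
      simp [Matrix.mul_apply, Fin.sum_univ_two, Matrix.SpecialLinearGroup.coe_inv,
        Matrix.adjugate_fin_two]
      ring
    rw [hent, r1, r2, s1, s2]
    rcases h with h | h <;> rw [h]
    · ring
    · simp only [Prod.fst_neg, Prod.snd_neg, Int.cast_neg]; ring

/-- The congruences satisfied by the pair attached to an element of `Γ₀(fM)` with lower right
entry `D`. -/
lemma rowPair_modEq {N f M : ℕ} (hf : 0 < f) (hN : f * M = N) (u : ℤ)
    (γ : CongruenceSubgroup.Gamma0 N) :
    (-u : ZMod M) = ((rowPair f u γ).1 : ZMod M) * ((γ : SL(2, ℤ)) 1 1 : ℤ) ∧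
      (((γ : SL(2, ℤ)) 1 1 : ℤ) : ZMod f) = ((rowPair f u γ).2 : ZMod f) := by
  have h2 := det_eq (γ : SL(2, ℤ))
  obtain ⟨t, ht⟩ := dvd_apply_one_zero γ
  have hNZ : (N : ℤ) = f * M := by exact_mod_cast hN.symm
  constructor
  · have hdiv : (γ : SL(2, ℤ)) 1 0 / f = M * t := by
      rw [ht, hNZ, mul_assoc, Int.mul_ediv_cancel_left _ (by exact_mod_cast hf.ne')]
    rw [← Int.cast_neg, ← Int.cast_mul, ZMod.intCast_eq_intCast_iff_dvd_sub]
    refine ⟨t * (γ : SL(2, ℤ)) 1 1 - u * (γ : SL(2, ℤ)) 0 1 * f * t, ?_⟩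
    simp only [rowPair, hdiv]
    rw [ht, hNZ] at h2
    linear_combination (-u) * h2
  · simp [rowPair]

/-- Every coprime pair satisfying the congruences comes from an element of `Γ₀(fM)`. -/
lemma exists_rowPair_eq {N f M : ℕ} (hf : 0 < f) (hN : f * M = N) {u : ℤ}
    (hu : IsCoprime u (N : ℤ)) {c d e : ℤ} (hcd : IsCoprime c d) (he : IsCoprime e (N : ℤ))
    (h1 : (M : ℤ) ∣ c * e + u) (h2 : (f : ℤ) ∣ d - e) :
    ∃ γ : CongruenceSubgroup.Gamma0 N, rowPair f u γ = (c, d) := by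
  have hNZ : (N : ℤ) = f * M := by exact_mod_cast hN.symm
  obtain ⟨p, hp⟩ := h1
  obtain ⟨q, hq⟩ := h2
  have hfd : IsCoprime (f : ℤ) d := by
    have h3 : IsCoprime (f : ℤ) e := (he.of_isCoprime_of_dvd_right ⟨M, hNZ⟩).symm
    rw [show d = e + f * q by linarith]
    exact h3.add_mul_left_right q
  have huM : IsCoprime u (M : ℤ) := hu.of_isCoprime_of_dvd_right ⟨f, by rw [hNZ]; ring⟩
  have hcM : IsCoprime c (M : ℤ) := by
    have h3 : IsCoprime (c * e) (M : ℤ) := by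
      rw [show c * e = -u + M * p by linarith]
      exact huM.neg_left.add_mul_left_left p
    exact h3.of_mul_left_left
  obtain ⟨B₀, A₀, hAB⟩ := hfd.mul_left hcd
  obtain ⟨l, m, hlm⟩ := huM.mul_left hcM
  -- `uA₀ + c` is divisible by `(f, M)`, which makes the congruence for `t` below solvable
  have hg : ((Int.gcd f M : ℕ) : ℤ) ∣ c + u * A₀ := by
    have hgf : ((Int.gcd f M : ℕ) : ℤ) ∣ f := Int.gcd_dvd_left ..
    have hgM : ((Int.gcd f M : ℕ) : ℤ) ∣ M := Int.gcd_dvd_right ..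
    refine ((hfd.of_isCoprime_of_dvd_left hgf)).dvd_of_dvd_mul_left ?_
    have : d * (c + u * A₀) = f * (q * c - u * B₀ * c) + M * p := by
      linear_combination c * hq + hp + u * hAB
    rw [this]
    exact (hgf.mul_right _).add (hgM.mul_right _)
  obtain ⟨r, hr⟩ := hg
  have hbez := Int.gcd_eq_gcd_ab f M
  set α := Int.gcdA f M
  set β := Int.gcdB f M
  -- `t` solves `t u f c ≡ -(uA₀ + c)` modulo `M`: here `l` inverts `uc` and `f α ≡ (f, M)`
  set t := -(r * α * l) with ht
  obtain ⟨γ, e00, e01, e10, e11⟩ := exists_gamma0 (N := N) (A₀ + t * f * c) (-B₀ + t * d)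
    (u * f * (A₀ + t * f * c) + f * c) (u * f * (-B₀ + t * d) + d)
    (by linear_combination hAB) (by
      refine ⟨r * β + r * α * f * m, ?_⟩
      rw [hNZ, ht]
      rw [hbez] at hr
      linear_combination (f : ℤ) * hr - f * r * α * f * hlm)
  refine ⟨γ, ?_⟩
  have hf' : (f : ℤ) ≠ 0 := by exact_mod_cast hf.ne'
  rw [rowPair, e00, e01, e10, e11, show u * f * (A₀ + t * f * c) + f * c =
    f * (u * (A₀ + t * f * c) + c) by ring, Int.mul_ediv_cancel_left _ hf']
  exact Prod.ext (by ring) (by ring)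

/-! ### The cusp series as a combination of series of imprimitive characters -/

lemma jFactor_zpow_neg (k : ℤ) (g : SL(2, ℝ)) (z : ℍ) :
    jFactor g z ^ (-k) = ((‖(g 1 0 : ℂ) * z + g 1 1‖ : ℂ) / ((g 1 0 : ℂ) * z + g 1 1)) ^ k := by
  rw [jFactor, zpow_neg, ← inv_zpow, inv_div]

lemma im_smul_SL (g : SL(2, ℝ)) (z : ℍ) :
    (g • z).im = z.im / ‖(g 1 0 : ℂ) * z + g 1 1‖ ^ 2 := by
  have h := UpperHalfPlane.im_smul_eq_div_normSq (Matrix.SpecialLinearGroup.toGL g) z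
  rw [← Complex.normSq_eq_norm_sq]
  refine Eq.trans h ?_
  simp [denom]

/-- The summand of the cusp series in terms of the pair attached to `γ`. -/
lemma cuspTerm_eq {N f : ℕ} [NeZero N] (hf : f ∣ N) (u : ℤ) (ψ : DirichletCharacter ℂ N) (k : ℤ)
    {σ : SL(2, ℝ)} (h10 : σ 1 0 = u * f * σ 0 0) {w : ℕ} (hw : σ 0 0 ^ 2 = w) (hw0 : 0 < w)
    (hσk : Odd k → 0 < σ 0 0) (z : ℍ) (s : ℂ) (γ : CongruenceSubgroup.Gamma0 N) :
    ((f * w : ℕ) : ℂ) ^ s * cuspTerm ψ k σ z s γ =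
      starRingEnd ℂ (nebentypus ψ γ) * (((f * z.im : ℝ) : ℂ) ^ s *
        weightKernel k s (((rowPair f u γ).1 : ℂ) * (f * z) + (rowPair f u γ).2)) := by
  obtain ⟨r1, r2⟩ := lower_row_inv_mul hf u h10 γ
  set v : ℂ := ((rowPair f u γ).1 : ℂ) * (f * z) + (rowPair f u γ).2 with hv
  have hfR : (0 : ℝ) < f := by
    exact_mod_cast Nat.pos_of_dvd_of_pos hf (Nat.pos_of_ne_zero (NeZero.ne N))
  have hwR : (0 : ℝ) < w := by exact_mod_cast hw0
  have ha : σ 0 0 ≠ 0 := by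
    intro h
    rw [h, zero_pow two_ne_zero] at hw
    exact hwR.ne hw
  have haC : ((σ 0 0 : ℝ) : ℂ) ≠ 0 := by exact_mod_cast ha
  have hv0 : v ≠ 0 := by
    have hz : ((posScale f hfR z : ℍ) : ℂ) = f * z := by simp [posScale]
    have hne : ![((rowPair f u γ).1 : ℝ), ((rowPair f u γ).2 : ℝ)] ≠ 0 := by
      intro h0
      have h1 := congrFun h0 0
      have h2 := congrFun h0 1
      simp at h1 h2
      have := isCoprime_rowPair hf u γ
      rw [h1, h2] at this
      exact not_isCoprime_zero_zero this
    have := linear_ne_zero (posScale f hfR z) hne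
    rw [hz] at this
    simpa [hv] using this
  have hrow : (((σ⁻¹ * toSLReal γ) 1 0 : ℝ) : ℂ) * z + (((σ⁻¹ * toSLReal γ) 1 1 : ℝ) : ℂ) =
      (σ 0 0 : ℂ) * v := by
    rw [r1, r2, hv]; push_cast; ring
  have hnv : 0 < ‖v‖ := norm_pos_iff.mpr hv0
  rw [cuspTerm, jFactor_zpow_neg, im_smul_SL, hrow, norm_mul, Complex.norm_real, mul_pow,
    Real.norm_eq_abs, sq_abs, hw]
  have hsign : (((|σ 0 0| * ‖v‖ : ℝ) : ℂ) / ((σ 0 0 : ℂ) * v)) ^ k = ((‖v‖ : ℂ) / v) ^ k := by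
    rw [Complex.ofReal_mul, mul_div_mul_comm, mul_zpow]
    -- the sign of the upper left entry of `σ` only matters for odd `k`
    suffices h : (((|σ 0 0| : ℝ) : ℂ) / (σ 0 0 : ℂ)) ^ k = 1 by rw [h, one_mul]
    rcases lt_or_gt_of_ne ha with h | h
    · have hk : Even k := by
        rw [← Int.not_odd_iff_even]
        exact fun hk => (hσk hk).not_gt h
      rw [abs_of_neg h, Complex.ofReal_neg, neg_div, div_self haC, hk.neg_one_zpow]
    · rw [abs_of_pos h, div_self haC, one_zpow]
  have him : ((z.im / (w * ‖v‖ ^ 2) : ℝ) : ℂ) ^ s * (w : ℂ) ^ s * (‖v‖ : ℂ) ^ (2 * s) =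
      (z.im : ℂ) ^ s := by
    have h2 : (‖v‖ : ℂ) ^ (2 * s) = ((‖v‖ ^ 2 : ℝ) : ℂ) ^ s := by
      rw [pow_two, Complex.ofReal_mul, Complex.mul_cpow_ofReal_nonneg hnv.le hnv.le, two_mul,
        Complex.cpow_add _ _ (by exact_mod_cast hnv.ne')]
    have h3 : (w : ℂ) ^ s = ((w : ℝ) : ℂ) ^ s := by simp
    have hz := z.im_pos
    rw [h2, h3, ← Complex.mul_cpow_ofReal_nonneg (by positivity) hwR.le, ← Complex.ofReal_mul,
      ← Complex.mul_cpow_ofReal_nonneg (by positivity) (by positivity), ← Complex.ofReal_mul]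
    congr 2
    field_simp
  have hnvs : (‖v‖ : ℂ) ^ (2 * s) ≠ 0 := by
    rw [Complex.cpow_ne_zero_iff]; left; exact_mod_cast hnv.ne'
  have hf1 : ((f * z.im : ℝ) : ℂ) ^ s = (f : ℂ) ^ s * (z.im : ℂ) ^ s := by
    rw [Complex.ofReal_mul, Complex.mul_cpow_ofReal_nonneg hfR.le z.im_pos.le]
    simp
  rw [hsign, weightKernel, hf1, ← him, Nat.cast_mul, Complex.natCast_mul_natCast_cpow]
  field_simp

/-- Singularity of the cusp `1 / (uf)` means that `ψ` is trivial on the residue classes that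
are `1` both modulo `f` and modulo `M`. -/
lemma IsSingular.apply_eq_one {N f M : ℕ} [NeZero N] (hf : 0 < f) (hM : 0 < M) (hN : f * M = N)
    {u : ℤ} (hu : IsCoprime u (N : ℤ)) (hu0 : u ≠ 0) {ψ : DirichletCharacter ℂ N}
    (hsing : IsSingular ψ (((1 / ((u : ℝ) * (f : ℝ)) : ℝ)) : OnePoint ℝ))
    (hM' : M ∣ N) (hf' : f ∣ N) (e : (ZMod N)ˣ)
    (h1 : ZMod.unitsMap hM' e = 1) (h2 : ZMod.unitsMap hf' e = 1) : ψ e = 1 := by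
  obtain ⟨σ, hσ, τ, hτ, hψ⟩ := hsing
  have h10 := scaling_apply_one_zero hf hu0 hσ.1
  have hsq := scaling_apply_zero_zero_sq hf hM hN hu hu0 hσ
  obtain ⟨w, hw⟩ := Nat.gcd_dvd_right f M
  have hg : 0 < Nat.gcd f M := Nat.gcd_pos_of_pos_left _ hf
  have hwdiv : M / Nat.gcd f M = w := Nat.div_eq_of_eq_mul_right hg hw
  rw [hwdiv] at hsq
  have hτ11 : (τ : SL(2, ℤ)) 1 1 = 1 + u * (f * w : ℤ) := by
    have := congrArg (fun g : SL(2, ℝ) => g 1 1) hτ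
    simp only [conj_unipotent, toSLReal_apply] at this
    simp only [Matrix.of_apply, Matrix.cons_val', Matrix.cons_val_one,
      Matrix.cons_val_fin_one, h10] at this
    have h3 : (((τ : SL(2, ℤ)) 1 1 : ℤ) : ℝ) = ((1 + u * (f * w : ℤ) : ℤ) : ℝ) := by
      rw [this]; push_cast; rw [← hsq]; ring
    exact_mod_cast h3
  rw [nebentypus, hτ11] at hψ
  obtain ⟨n, hn⟩ := ZMod.intCast_surjective (e : ZMod N)
  rw [← hn]
  have hone (m : ℕ) : (n : ZMod m) = 1 ↔ (m : ℤ) ∣ n - 1 := by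
    rw [← sub_eq_zero, ← Int.cast_one, ← Int.cast_sub, ZMod.intCast_zmod_eq_zero_iff_dvd]
  simp only [Units.ext_iff, ZMod.unitsMap_val, ← hn, Units.val_one] at h1 h2
  rw [ZMod.cast_intCast hM', hone] at h1
  rw [ZMod.cast_intCast hf', hone] at h2
  obtain ⟨f', hf''⟩ := Nat.gcd_dvd_left f M
  -- `f M / (f, M)` is the least common multiple of `f` and `M`
  have hlcm : Nat.lcm f M = f * w := by
    rw [Nat.lcm]
    refine Nat.div_eq_of_eq_mul_left hg ?_
    conv_lhs => rw [hw]
    ring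
  refine apply_eq_one_of_modEq ψ hu ⟨f' * w, ?_⟩ hψ ?_
  · have hNZ : N = f * (Nat.gcd f M * w) := by rw [← hw, hN]
    rw [hNZ]
    have hfZ : (f : ℤ) = Nat.gcd f M * f' := by exact_mod_cast hf''
    push_cast
    linear_combination (f : ℤ) * w ^ 2 * hfZ
  · have := Int.coe_lcm_dvd h2 h1
    rw [Int.lcm, Int.natAbs_natCast, Int.natAbs_natCast, hlcm] at this
    exact_mod_cast this

/-- The pairs have the parity of `ψ`, as `X₂(-1)` is real. -/
lemma quotientPairs_apply_neg_one {M₁ M₂ N : ℕ} [NeZero M₁] [NeZero M₂] [NeZero N]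
    {h₁ : M₁ ∣ N} {h₂ : M₂ ∣ N} {ψ : DirichletCharacter ℂ N}
    {X : DirichletCharacter ℂ M₁ × DirichletCharacter ℂ M₂} (hX : X ∈ quotientPairs h₁ h₂ ψ) :
    X.1 (-1) * X.2 (-1) = ψ (-1) := by
  rw [mem_quotientPairs] at hX
  have h := congrArg (fun χ : DirichletCharacter ℂ N => χ ((-1 : ℤ) : ZMod N)) hX
  have hcop (n : ℕ) : IsCoprime (-1 : ℤ) (n : ℤ) := isCoprime_one_left.neg_left
  simp only [← MulChar.star_eq_inv, MulChar.mul_apply, MulChar.star_apply,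
    changeLevel_apply_intCast, hcop, if_true] at h
  push_cast at h
  rw [← h, ← starRingEnd_apply, conj_apply_isUnit _ isUnit_one.neg]
  have h1 : (-1 : ZMod M₂)⁻¹ = -1 := by
    have := ZMod.inv_mul_of_unit (-1 : ZMod M₂) isUnit_one.neg
    linear_combination -this
  rw [h1]

lemma latticeTerm_neg {q₁ q₂ : ℕ} (χ₁ : DirichletCharacter ℂ q₁) (χ₂ : DirichletCharacter ℂ q₂)
    {k : ℤ} (h : χ₁ (-1) * χ₂ (-1) = (-1) ^ k) (x s : ℂ) (p : ℤ × ℤ) :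
    latticeTerm χ₁ χ₂ k x s (-p) = latticeTerm χ₁ χ₂ k x s p := by
  have h1 : ((-p).1 : ℂ) * x + (-p).2 = -((p.1 : ℂ) * x + p.2) := by
    simp only [Prod.fst_neg, Prod.snd_neg]; push_cast; ring
  have h2 : (((-p).1 : ℤ) : ZMod q₁) = -1 * p.1 := by simp
  have h3 : (((-p).2 : ℤ) : ZMod q₂) = -1 * p.2 := by simp
  have hk : ((-1 : ℂ) ^ k) * (-1) ^ k = 1 := by
    rw [← mul_zpow]; simp
  rw [latticeTerm, h1, h2, h3, weightKernel_neg, map_mul, map_mul, latticeTerm]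
  linear_combination (χ₁ p.1 * χ₂ p.2 * weightKernel k s ((p.1 : ℂ) * x + p.2)) *
    ((-1) ^ k * h + hk)

/-- The coprime pairs `± (c, d)` attached to the chosen representative of a coset. -/
def signedRowPair {N f : ℕ} (hf : f ∣ N) (u : ℤ) (a : OnePoint ℝ) (x : ℤˣ × CuspCosets N a) :
    {p : ℤ × ℤ // IsCoprime p.1 p.2} :=
  ⟨x.1 • rowPair f u x.2.out, by
    have h := isCoprime_rowPair hf u x.2.out
    rcases Int.units_eq_one_or x.1 with h1 | h1 <;> rw [h1]
    · simpa using h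
    · simpa using h.neg_neg⟩

/-- Distinct cosets give pairs distinct up to sign, and a coprime pair differs from its negative. -/
lemma signedRowPair_injective {N f : ℕ} [NeZero N] (hf : f ∣ N) {u : ℤ} (hu0 : u ≠ 0)
    {σ : SL(2, ℝ)}
    (hσ : IsScalingMatrix N (((1 / ((u : ℝ) * (f : ℝ)) : ℝ)) : OnePoint ℝ) σ) :
    Function.Injective (signedRowPair hf u (((1 / ((u : ℝ) * (f : ℝ)) : ℝ)) : OnePoint ℝ)) := by
  rintro ⟨ε, x⟩ ⟨η, y⟩ h
  have h' : ε • rowPair f u x.out = η • rowPair f u y.out := congrArg Subtype.val h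
  have hor : rowPair f u y.out = rowPair f u x.out ∨ rowPair f u y.out = -rowPair f u x.out := by
    rcases Int.units_eq_one_or ε with rfl | rfl <;> rcases Int.units_eq_one_or η with rfl | rfl <;>
      simp only [one_smul, Units.neg_smul] at h'
    · exact Or.inl h'.symm
    · exact Or.inr (by rw [h', neg_neg])
    · exact Or.inr h'.symm
    · exact Or.inl (neg_injective h').symm
  have hxy : x = y := by
    rw [← Quotient.out_equiv_out]
    exact QuotientGroup.rightRel_apply.mpr
      ((mul_inv_mem_cuspStabilizer_iff hf hu0 hσ _ _).mpr hor)
  subst hxy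
  have hne : rowPair f u x.out ≠ 0 := by
    intro h0
    have := isCoprime_rowPair hf u x.out
    rw [h0] at this
    exact not_isCoprime_zero_zero this
  have hne2 : rowPair f u x.out ≠ -rowPair f u x.out := by
    intro h0
    refine hne (Prod.ext ?_ ?_)
    · have := congrArg Prod.fst h0
      simp only [Prod.fst_neg] at this
      simp only [Prod.fst_zero]; omega
    · have := congrArg Prod.snd h0
      simp only [Prod.snd_neg] at this
      simp only [Prod.snd_zero]; omega
  congr 1
  rcases Int.units_eq_one_or ε with rfl | rfl <;> rcases Int.units_eq_one_or η with rfl | rfl <;>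
    simp only [one_smul, Units.neg_smul] at h' ⊢
  · exact absurd h' hne2
  · exact absurd h'.symm hne2

/-- All pairs attached to elements of `Γ₀(N)` occur up to sign at the chosen representatives. -/
lemma mem_range_signedRowPair {N f : ℕ} [NeZero N] (hf : f ∣ N) {u : ℤ} (hu0 : u ≠ 0)
    {σ : SL(2, ℝ)}
    (hσ : IsScalingMatrix N (((1 / ((u : ℝ) * (f : ℝ)) : ℝ)) : OnePoint ℝ) σ)
    {p : {p : ℤ × ℤ // IsCoprime p.1 p.2}} {γ : CongruenceSubgroup.Gamma0 N}
    (hγ : rowPair f u γ = p) :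
    p ∈ Set.range (signedRowPair hf u (((1 / ((u : ℝ) * (f : ℝ)) : ℝ)) : OnePoint ℝ)) := by
  set x : CuspCosets N (((1 / ((u : ℝ) * (f : ℝ)) : ℝ)) : OnePoint ℝ) := ⟦γ⟧ with hx
  have h1 : (QuotientGroup.rightRel (cuspStabilizer N
      (((1 / ((u : ℝ) * (f : ℝ)) : ℝ)) : OnePoint ℝ))) x.out γ := Quotient.mk_out γ
  rw [QuotientGroup.rightRel_apply, mul_inv_mem_cuspStabilizer_iff hf hu0 hσ] at h1
  rcases h1 with h1 | h1
  · exact ⟨(1, x), Subtype.ext (by simp [signedRowPair, ← h1, hγ])⟩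
  · exact ⟨(-1, x), Subtype.ext (by simp [signedRowPair, ← h1, hγ])⟩

/-- The cusp series is the combination, with coefficients `X̄₁(-u)`, of the series of all pairs of
(possibly imprimitive) characters `X₁` modulo `N / f` and `X₂` modulo `f` with `X₁ X̄₂ = ψ`. -/
theorem cuspEisenstein_eq_sum_quotientPairs {N f M : ℕ} [NeZero N] [NeZero f] [NeZero M]
    (hN : f * M = N) (hM : M ∣ N) (hf : f ∣ N) {u : ℤ} (hu : IsCoprime u (N : ℤ)) (hu0 : u ≠ 0)
    {k : ℤ} {ψ : DirichletCharacter ℂ N} (hψ : ψ (-1) = (-1 : ℂ) ^ k)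
    (hsing : IsSingular ψ (((1 / ((u : ℝ) * (f : ℝ)) : ℝ)) : OnePoint ℝ)) {σ : SL(2, ℝ)}
    (hσ : IsScalingMatrix N (((1 / ((u : ℝ) * (f : ℝ)) : ℝ)) : OnePoint ℝ) σ)
    (hσk : Odd k → 0 < σ 0 0) (z : ℍ) {s : ℂ} (hs : 1 < s.re) :
    Summable (fun x : CuspCosets N (((1 / ((u : ℝ) * (f : ℝ)) : ℝ)) : OnePoint ℝ) =>
        cuspTerm ψ k σ z s x.out) ∧
      cuspEisenstein ψ k (((1 / ((u : ℝ) * (f : ℝ)) : ℝ)) : OnePoint ℝ) σ z s =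
        1 / (((f * (M / Nat.gcd f M) : ℕ) : ℂ) ^ s) * (1 / (Nat.totient (Nat.gcd f M) : ℂ)) *
          ∑ X ∈ quotientPairs hM hf ψ,
            starRingEnd ℂ (X.1 (-(u : ZMod M))) * charEisenstein X.1 X.2 k z s := by
  have hf0 : 0 < f := Nat.pos_of_ne_zero (NeZero.ne f)
  have hM0 : 0 < M := Nat.pos_of_ne_zero (NeZero.ne M)
  have hw0 : 0 < M / Nat.gcd f M := Nat.div_pos (Nat.gcd_le_right _ hM0)
    (Nat.gcd_pos_of_pos_left _ hf0)
  have hsq := scaling_apply_zero_zero_sq hf0 hM0 hN hu hu0 hσ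
  have h10 := scaling_apply_one_zero hf0 hu0 hσ.1
  have hNZ : (N : ℤ) = f * M := by exact_mod_cast hN.symm
  set w := M / Nat.gcd f M
  set a : OnePoint ℝ := (((1 / ((u : ℝ) * (f : ℝ)) : ℝ)) : OnePoint ℝ) with ha
  have hv : IsUnit (-(u : ZMod M)) := by
    refine IsUnit.neg ((ZMod.coe_int_isUnit_iff_isCoprime u M).mpr ?_)
    exact (hu.of_isCoprime_of_dvd_right ⟨f, by rw [hNZ]; ring⟩).symm
  set K : ℂ := (Nat.totient (Nat.gcd f M) : ℂ) * ((f * w : ℕ) : ℂ) ^ s with hK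
  have hfw : ((f * w : ℕ) : ℂ) ^ s ≠ 0 := by
    rw [Complex.cpow_ne_zero_iff]; left
    exact_mod_cast (Nat.mul_pos hf0 hw0).ne'
  have hφ : (Nat.totient (Nat.gcd f M) : ℂ) ≠ 0 := by
    exact_mod_cast (Nat.totient_pos.mpr (Nat.gcd_pos_of_pos_left _ hf0)).ne'
  have hK0 : K ≠ 0 := mul_ne_zero hφ hfw
  -- the summand of the right-hand side, and its value at the pair of a matrix
  set T : {p : ℤ × ℤ // IsCoprime p.1 p.2} → ℂ := fun p => ∑ X ∈ quotientPairs hM hf ψ,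
    starRingEnd ℂ (X.1 (-(u : ZMod M))) * charTerm X.1 X.2 k z s p with hT
  have hTsum : Summable T := summable_sum fun X _ =>
    (summable_charTerm X.1 X.2 hf0 k z hs).mul_left _
  have hTfac (p : {p : ℤ × ℤ // IsCoprime p.1 p.2}) : T p =
      (∑ X ∈ quotientPairs hM hf ψ, starRingEnd ℂ (X.1 (-(u : ZMod M))) * X.1 (p.1.1 : ZMod M) *
        X.2 (p.1.2 : ZMod f)) * (((f * (z : ℂ).im : ℝ) : ℂ) ^ s *
          weightKernel k s ((p.1.1 : ℂ) * (f * z) + p.1.2)) := by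
    rw [hT, Finset.sum_mul]
    refine Finset.sum_congr rfl fun X _ => ?_
    rw [charTerm_eq, latticeTerm]
    ring
  have hTneg (p q : {p : ℤ × ℤ // IsCoprime p.1 p.2}) (hpq : q.1 = -p.1) : T q = T p := by
    refine Finset.sum_congr rfl fun X hX => ?_
    rw [charTerm_eq, charTerm_eq, hpq,
      latticeTerm_neg _ _ ((quotientPairs_apply_neg_one hX).trans hψ)]
  have hTrow (γ : CongruenceSubgroup.Gamma0 N) (p : {p : ℤ × ℤ // IsCoprime p.1 p.2})
      (hp : rowPair f u γ = p.1) : T p = K * cuspTerm ψ k σ z s γ := by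
    obtain ⟨c1, c2⟩ := rowPair_modEq hf0 hN u γ
    have hunit : IsUnit (((γ : SL(2, ℤ)) 1 1 : ℤ) : ZMod N) := by
      refine (ZMod.coe_int_isUnit_iff_isCoprime _ N).mpr ?_
      obtain ⟨t, ht⟩ := dvd_apply_one_zero γ
      have hdet := det_eq (γ : SL(2, ℤ))
      rw [ht] at hdet
      exact ⟨-((γ : SL(2, ℤ)) 0 1 * t), (γ : SL(2, ℤ)) 0 0, by linear_combination hdet⟩
    obtain ⟨e, he⟩ := hunit
    have he1 (m : ℕ) (hm : m ∣ N) : ((ZMod.unitsMap hm e : (ZMod m)ˣ) : ZMod m) =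
        (((γ : SL(2, ℤ)) 1 1 : ℤ) : ZMod m) := by
      rw [ZMod.unitsMap_val, he, ZMod.cast_intCast hm]
    have key := sum_quotientPairs_eq_conj (by rw [mul_comm]; exact hN) hM hf ψ
      (fun e' h1 h2 => hsing.apply_eq_one hf0 hM0 hN hu hu0 hM hf e' h1 h2) hv
      ((rowPair f u γ).1 : ZMod M) ((rowPair f u γ).2 : ZMod f) e
      (by rw [he1]; exact c1) (by rw [he1]; exact c2)
    have hterm := cuspTerm_eq hf u ψ k h10 hsq hw0 hσk z s γ
    rw [hTfac, ← hp, key, he, Nat.gcd_comm, hK, mul_assoc _ (((f * w : ℕ) : ℂ) ^ s), hterm]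
    simp only [nebentypus, UpperHalfPlane.coe_im]
    ring
  have hTx (x : ℤˣ × CuspCosets N a) : T (signedRowPair hf u a x) =
      K * cuspTerm ψ k σ z s x.2.out := by
    rcases x with ⟨ε, x⟩
    rcases Int.units_eq_one_or ε with rfl | rfl
    · exact hTrow _ _ (by simp [signedRowPair])
    · rw [hTneg (signedRowPair hf u a (1, x)) _ (by simp [signedRowPair])]
      exact hTrow _ _ (by simp [signedRowPair])
  have hinj := signedRowPair_injective hf hu0 hσ
  have hrange : Function.support T ⊆ Set.range (signedRowPair hf u a) := by
    intro p hp
    rw [Function.mem_support, hTfac] at hp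
    obtain ⟨e, e1, e2⟩ := exists_of_sum_quotientPairs_ne_zero hM hf ψ hv _ _
      (left_ne_zero_of_mul hp)
    obtain ⟨n, hn⟩ := ZMod.intCast_surjective (e : ZMod N)
    have hcop : IsCoprime n (N : ℤ) :=
      ((ZMod.coe_int_isUnit_iff_isCoprime n N).mp (hn ▸ e.isUnit)).symm
    rw [ZMod.unitsMap_val, ← hn, ZMod.cast_intCast hM, ← Int.cast_neg, ← Int.cast_mul,
      ZMod.intCast_eq_intCast_iff_dvd_sub] at e1
    rw [ZMod.unitsMap_val, ← hn, ZMod.cast_intCast hf, ZMod.intCast_eq_intCast_iff_dvd_sub] at e2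
    obtain ⟨γ, hγ⟩ := exists_rowPair_eq hf0 hN hu p.2 hcop (by simpa using e1) e2
    exact mem_range_signedRowPair hf hu0 hσ hγ
  -- the cusp series is a sum of `K⁻¹ T` over the injective family of pairs attached to cosets
  have hS : Summable fun x : ℤˣ × CuspCosets N a => cuspTerm ψ k σ z s x.2.out := by
    have := (hTsum.comp_injective hinj).mul_left K⁻¹
    refine this.congr fun x => ?_
    rw [Function.comp_apply, hTx, inv_mul_cancel_left₀ hK0]
  have hS1 : Summable fun x : CuspCosets N a => cuspTerm ψ k σ z s x.out :=
    hS.comp_injective (i := fun x => ((1 : ℤˣ), x)) fun _ _ h => (Prod.mk.inj h).2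
  refine ⟨hS1, ?_⟩
  have htotal : ∑' p, T p = K * (2 * cuspEisenstein ψ k a σ z s) := by
    rw [← hinj.tsum_eq hrange, tsum_congr hTx, tsum_mul_left, hS.tsum_prod, tsum_fintype]
    simp [cuspEisenstein]
  have hswap : ∑' p, T p = ∑ X ∈ quotientPairs hM hf ψ, ∑' p,
      starRingEnd ℂ (X.1 (-(u : ZMod M))) * charTerm X.1 X.2 k z s p :=
    Summable.tsum_finsetSum fun X _ => (summable_charTerm X.1 X.2 hf0 k z hs).mul_left _
  have htotal' : ∑' p, T p = 2 * ∑ X ∈ quotientPairs hM hf ψ,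
      starRingEnd ℂ (X.1 (-(u : ZMod M))) * charEisenstein X.1 X.2 k z s := by
    rw [hswap, Finset.mul_sum]
    refine Finset.sum_congr rfl fun X _ => ?_
    rw [tsum_mul_left, charEisenstein]
    ring
  rw [htotal] at htotal'
  have h2 : K * cuspEisenstein ψ k a σ z s = _ :=
    mul_left_cancel₀ two_ne_zero ((mul_left_comm _ _ _).trans htotal')
  rw [← h2, hK]
  field_simp

/-! ### Sorting characters by their conductors -/

lemma exists_isPrimitive_changeLevel_eq {M q : ℕ} (X : DirichletCharacter ℂ M)
    (h : X.conductor = q) (hq : q ∣ M) : ∃ χ : DirichletCharacter ℂ q, χ.IsPrimitive ∧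
      DirichletCharacter.changeLevel hq χ = X := by
  subst h
  exact ⟨X.primitiveCharacter, X.primitiveCharacter_isPrimitive, X.changeLevel_primitiveCharacter⟩

/-- `χ₁ χ̄₂ ∼ ψ` is an equality of characters modulo the common multiple `N` of the moduli. -/
lemma samePrimitive_iff_mem_quotientPairs {q₁ q₂ M₁ M₂ N : ℕ} [NeZero M₁] [NeZero M₂] [NeZero N]
    (hM₁ : M₁ ∣ N) (hM₂ : M₂ ∣ N) (h₁ : q₁ ∣ M₁) (h₂ : q₂ ∣ M₂) (χ₁ : DirichletCharacter ℂ q₁)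
    (χ₂ : DirichletCharacter ℂ q₂) (ψ : DirichletCharacter ℂ N) :
    SamePrimitive (χ₁.mul (star χ₂)) ψ ↔
      (DirichletCharacter.changeLevel h₁ χ₁, DirichletCharacter.changeLevel h₂ χ₂) ∈
        quotientPairs hM₁ hM₂ ψ := by
  have hl : Nat.lcm q₁ q₂ ∣ N := Nat.lcm_dvd (h₁.trans hM₁) (h₂.trans hM₂)
  have hlift : DirichletCharacter.changeLevel hM₁ (DirichletCharacter.changeLevel h₁ χ₁) *
      (DirichletCharacter.changeLevel hM₂ (DirichletCharacter.changeLevel h₂ χ₂))⁻¹ =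
      DirichletCharacter.changeLevel hl (χ₁.mul (star χ₂)) := by
    rw [DirichletCharacter.mul, map_mul, ← DirichletCharacter.changeLevel_trans,
      ← DirichletCharacter.changeLevel_trans, ← DirichletCharacter.changeLevel_trans,
      ← DirichletCharacter.changeLevel_trans, MulChar.star_eq_inv, map_inv]
  rw [mem_quotientPairs, hlift]
  constructor
  · rintro ⟨d, hm, hn, θ, -, e1, e2⟩
    rw [e1, e2, ← DirichletCharacter.changeLevel_trans]
  · intro h
    refine ⟨_, DirichletCharacter.conductor_dvd_level (χ₁.mul (star χ₂)),
      (DirichletCharacter.conductor_dvd_level _).trans hl, (χ₁.mul (star χ₂)).primitiveCharacter,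
      DirichletCharacter.primitiveCharacter_isPrimitive _,
      (DirichletCharacter.changeLevel_primitiveCharacter _).symm, ?_⟩
    rw [DirichletCharacter.changeLevel_trans _ (DirichletCharacter.conductor_dvd_level _) hl,
      DirichletCharacter.changeLevel_primitiveCharacter, h]

lemma finsum_pairs_eq_sum {q₁ q₂ : ℕ} [NeZero q₁] [NeZero q₂]
    (P : DirichletCharacter ℂ q₁ → DirichletCharacter ℂ q₂ → Prop)
    [DecidablePred fun χ : DirichletCharacter ℂ q₁ × DirichletCharacter ℂ q₂ => P χ.1 χ.2]
    (G : DirichletCharacter ℂ q₁ → DirichletCharacter ℂ q₂ → ℂ) :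
    ∑ᶠ (χ₁ : DirichletCharacter ℂ q₁) (χ₂ : DirichletCharacter ℂ q₂) (_ : P χ₁ χ₂), G χ₁ χ₂ =
      ∑ χ : DirichletCharacter ℂ q₁ × DirichletCharacter ℂ q₂ with P χ.1 χ.2, G χ.1 χ.2 := by
  classical
  rw [Finset.sum_filter, Fintype.sum_prod_type, finsum_eq_sum_of_fintype]
  refine Finset.sum_congr rfl fun χ₁ _ => ?_
  rw [finsum_eq_sum_of_fintype]
  refine Finset.sum_congr rfl fun χ₂ _ => ?_
  by_cases h : P χ₁ χ₂ <;> simp [h]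

/-- A sum over pairs of characters, sorted by the primitive characters inducing them. -/
lemma sum_finsum_eq_sum_quotientPairs {M₁ M₂ N : ℕ} [NeZero M₁] [NeZero M₂] [NeZero N]
    (hM₁ : M₁ ∣ N) (hM₂ : M₂ ∣ N) (ψ : DirichletCharacter ℂ N)
    (H : DirichletCharacter ℂ M₁ × DirichletCharacter ℂ M₂ → ℂ)
    (G : ∀ q₁ q₂ : ℕ, DirichletCharacter ℂ q₁ → DirichletCharacter ℂ q₂ → ℂ)
    (hG : ∀ (q₁ q₂ : ℕ) (h₁ : q₁ ∣ M₁) (h₂ : q₂ ∣ M₂) (χ₁ : DirichletCharacter ℂ q₁)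
      (χ₂ : DirichletCharacter ℂ q₂), G q₁ q₂ χ₁ χ₂ =
        H (DirichletCharacter.changeLevel h₁ χ₁, DirichletCharacter.changeLevel h₂ χ₂)) :
    ∑ q₁ ∈ M₁.divisors, ∑ q₂ ∈ M₂.divisors,
      ∑ᶠ (χ₁ : DirichletCharacter ℂ q₁) (χ₂ : DirichletCharacter ℂ q₂)
        (_ : χ₁.IsPrimitive ∧ χ₂.IsPrimitive ∧ SamePrimitive (χ₁.mul (star χ₂)) ψ),
        G q₁ q₂ χ₁ χ₂ = ∑ X ∈ quotientPairs hM₁ hM₂ ψ, H X := by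
  classical
  have hmaps : ∀ X ∈ quotientPairs hM₁ hM₂ ψ, (X.1.conductor, X.2.conductor) ∈
      M₁.divisors ×ˢ M₂.divisors := fun X _ => by
    simp only [Finset.mem_product, Nat.mem_divisors]
    exact ⟨⟨X.1.conductor_dvd_level, NeZero.ne _⟩, ⟨X.2.conductor_dvd_level, NeZero.ne _⟩⟩
  rw [← Finset.sum_fiberwise_of_maps_to hmaps, Finset.sum_product]
  refine Finset.sum_congr rfl fun q₁ hq₁ => Finset.sum_congr rfl fun q₂ hq₂ => ?_
  have h₁ := Nat.dvd_of_mem_divisors hq₁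
  have h₂ := Nat.dvd_of_mem_divisors hq₂
  have : NeZero q₁ := ⟨(Nat.pos_of_mem_divisors hq₁).ne'⟩
  have : NeZero q₂ := ⟨(Nat.pos_of_mem_divisors hq₂).ne'⟩
  rw [finsum_pairs_eq_sum]
  refine Finset.sum_bij (fun χ _ => (DirichletCharacter.changeLevel h₁ χ.1,
    DirichletCharacter.changeLevel h₂ χ.2)) ?_ ?_ ?_ ?_
  · intro χ hχ
    simp only [Finset.mem_filter, Finset.mem_univ, true_and] at hχ
    rw [Finset.mem_filter, ← samePrimitive_iff_mem_quotientPairs]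
    refine ⟨hχ.2.2, ?_⟩
    rw [DirichletCharacter.conductor_changeLevel, DirichletCharacter.conductor_changeLevel,
      hχ.1, hχ.2.1]
  · intro χ _ χ' _ h
    simp only [Prod.mk.injEq] at h
    exact Prod.ext (DirichletCharacter.changeLevel_injective h₁ h.1)
      (DirichletCharacter.changeLevel_injective h₂ h.2)
  · rintro ⟨X₁, X₂⟩ hX
    simp only [Finset.mem_filter, Prod.mk.injEq] at hX
    obtain ⟨χ₁, p₁, rfl⟩ := exists_isPrimitive_changeLevel_eq X₁ hX.2.1 h₁
    obtain ⟨χ₂, p₂, rfl⟩ := exists_isPrimitive_changeLevel_eq X₂ hX.2.2 h₂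
    refine ⟨(χ₁, χ₂), ?_, rfl⟩
    simp only [Finset.mem_filter, Finset.mem_univ, true_and]
    exact ⟨p₁, p₂, (samePrimitive_iff_mem_quotientPairs hM₁ hM₂ h₁ h₂ χ₁ χ₂ ψ).mpr hX.1⟩
  · intro χ _
    exact hG q₁ q₂ h₁ h₂ χ.1 χ.2

/-- The two imprimitive forms of the product of `χ₁` and `χ₂` have the same `L`-series. -/
lemma dirichletL_mul_one {q₁ q₂ M₁ M₂ N : ℕ} (hM₁ : 0 < M₁) (hM₂ : 0 < M₂) (hN : M₁ * M₂ = N)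
    (h₁ : q₁ ∣ M₁) (h₂ : q₂ ∣ M₂) (χ₁ : DirichletCharacter ℂ q₁)
    (χ₂ : DirichletCharacter ℂ q₂) {s : ℂ} (hs : 1 < s.re) :
    dirichletL ((χ₁.mul χ₂).mul (1 : DirichletCharacter ℂ N)) s =
      dirichletL ((DirichletCharacter.changeLevel h₁ χ₁).mul
        (DirichletCharacter.changeLevel h₂ χ₂)) s := by
  have hq₁ := Nat.pos_of_dvd_of_pos h₁ hM₁
  have hq₂ := Nat.pos_of_dvd_of_pos h₂ hM₂
  have hN0 : 0 < N := hN ▸ Nat.mul_pos hM₁ hM₂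
  rw [← tsum_pnat_eq_dirichletL (Nat.lcm_pos (Nat.lcm_pos hq₁ hq₂) hN0) _ hs,
    ← tsum_pnat_eq_dirichletL (Nat.lcm_pos hM₁ hM₂) _ hs]
  refine tsum_congr fun n => ?_
  congr 1
  have e1 := mul_apply_intCast (χ₁.mul χ₂) (1 : DirichletCharacter ℂ N) ((n : ℕ) : ℤ)
  have e2 := mul_apply_intCast (DirichletCharacter.changeLevel h₁ χ₁)
    (DirichletCharacter.changeLevel h₂ χ₂) ((n : ℕ) : ℤ)
  have e3 := mul_apply_intCast χ₁ χ₂ ((n : ℕ) : ℤ)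
  have e4 : (1 : DirichletCharacter ℂ N) (((n : ℕ) : ℤ) : ZMod N) =
      if IsCoprime ((n : ℕ) : ℤ) (N : ℤ) then 1 else 0 := by
    split_ifs with h
    · exact MulChar.one_apply ((ZMod.coe_int_isUnit_iff_isCoprime _ N).mpr h.symm)
    · exact (DirichletCharacter.apply_eq_zero_iff _ _).mpr h
  have e5 : IsCoprime ((n : ℕ) : ℤ) (N : ℤ) ↔
      IsCoprime ((n : ℕ) : ℤ) (M₁ : ℤ) ∧ IsCoprime ((n : ℕ) : ℤ) (M₂ : ℤ) := by
    rw [← hN, Nat.cast_mul, IsCoprime.mul_right_iff]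
  rw [e3, e4] at e1
  rw [changeLevel_apply_intCast, changeLevel_apply_intCast] at e2
  rw [← Int.cast_natCast (R := ZMod _) (n : ℕ), ← Int.cast_natCast (R := ZMod _) (n : ℕ), e1, e2]
  simp only [e5]
  by_cases c1 : IsCoprime ((n : ℕ) : ℤ) (M₁ : ℤ) <;>
    by_cases c2 : IsCoprime ((n : ℕ) : ℤ) (M₂ : ℤ) <;> simp [c1, c2]

lemma apply_natCast_eq_zero {q : ℕ} (χ : DirichletCharacter ℂ q) {a : ℕ} (h : ¬ a.Coprime q) :
    χ (a : ZMod q) = 0 := by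
  have := (DirichletCharacter.apply_eq_zero_iff χ (a : ℤ)).mpr
    (by rwa [Nat.isCoprime_iff_coprime])
  simpa using this

/-- The combination of the series of primitive characters, as a sum over pairs of imprimitive
characters. -/
lemma charCombination_eq {N f : ℕ} [NeZero N] [NeZero f] [NeZero (N / f)] (hf : f ∣ N)
    (hM : N / f ∣ N) {u : ℤ} (hu : IsCoprime u (N : ℤ)) (ψ : DirichletCharacter ℂ N) (k : ℤ)
    (z : ℍ) {s : ℂ} (hs : 1 < s.re) :
    charCombination ψ f u (fun _ _ χ₁ χ₂ => charEisenstein χ₁ χ₂ k) z s =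
      1 / (((f * (N / f / Nat.gcd f (N / f)) : ℕ) : ℂ) ^ s) *
        (1 / (Nat.totient (Nat.gcd f (N / f)) : ℂ)) *
        ∑ X ∈ quotientPairs hM hf ψ,
          starRingEnd ℂ (X.1 (-(u : ZMod (N / f)))) * charEisenstein X.1 X.2 k z s := by
  have hf0 : 0 < f := Nat.pos_of_ne_zero (NeZero.ne f)
  have hM0 : 0 < N / f := Nat.pos_of_ne_zero (NeZero.ne _)
  have hs2 : 1 < (2 * s).re := by simp; linarith
  rw [charCombination]
  congr 1
  refine sum_finsum_eq_sum_quotientPairs hM hf ψ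
    (fun X => starRingEnd ℂ (X.1 (-(u : ZMod (N / f)))) * charEisenstein X.1 X.2 k z s)
    (fun q₁ q₂ χ₁ χ₂ => starRingEnd ℂ (χ₁ (-(u : ZMod q₁))) *
      (dirichletL (χ₁.mul χ₂) (2 * s) /
        dirichletL ((χ₁.mul χ₂).mul (1 : DirichletCharacter ℂ N)) (2 * s)) *
      ∑ a ∈ f.divisors with a.Coprime q₂, ∑ b ∈ (N / f).divisors with b.Coprime q₁,
        ((ArithmeticFunction.moebius a : ℂ) * (ArithmeticFunction.moebius b : ℂ) *
            χ₁ (b : ZMod q₁) * χ₂ (a : ZMod q₂)) / ((a * b : ℕ) : ℂ) ^ s *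
          charEisenstein χ₁ χ₂ k (((b * f : ℕ) : ℂ) / ((a * q₂ : ℕ) : ℂ) * z) s)
    fun q₁ q₂ h₁ h₂ χ₁ χ₂ => ?_
  have huM : IsCoprime (-u) ((N / f : ℕ) : ℤ) :=
    (hu.of_isCoprime_of_dvd_right (Int.natCast_dvd_natCast.mpr hM)).neg_left
  have hconj := changeLevel_apply_intCast h₁ χ₁ (-u)
  rw [if_pos huM] at hconj
  push_cast at hconj
  dsimp only
  rw [charEisenstein_changeLevel hM0 hf0 h₁ h₂ χ₁ χ₂ k z hs, hconj,
    dirichletL_mul_one hM0 hf0 (Nat.div_mul_cancel hf) h₁ h₂ χ₁ χ₂ hs2, mul_assoc]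
  congr 2
  rw [Finset.sum_filter_of_ne]
  · refine Finset.sum_congr rfl fun a _ => Finset.sum_filter_of_ne fun b _ hb => ?_
    by_contra h
    exact hb (by rw [apply_natCast_eq_zero χ₁ h]; simp)
  · intro a _ ha
    by_contra h
    exact ha (Finset.sum_eq_zero fun b _ => by rw [apply_natCast_eq_zero χ₂ h]; simp)

/-! ### Meromorphic continuation -/

/-- The only possible pole is that of a principal character at `1`, where `(s - 1) L(s, χ)` extends
to an entire function. -/
lemma meromorphicAt_dirichletL {q : ℕ} (hq : 0 < q) (χ : DirichletCharacter ℂ q) (s : ℂ) :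
    MeromorphicAt (dirichletL χ) s := by
  have : NeZero q := ⟨hq.ne'⟩
  have hfun : dirichletL χ = DirichletCharacter.LFunction χ := by
    ext s
    rw [dirichletL, dif_neg hq.ne']
  rw [hfun]
  by_cases hχ : χ = 1
  · subst hχ
    have h1 : MeromorphicAt (fun s => (s - 1)⁻¹ * DirichletCharacter.LFunctionTrivChar₁ q s) s :=
      (((analyticAt_id.sub analyticAt_const).meromorphicAt).inv).fun_mul
        ((DirichletCharacter.differentiable_LFunctionTrivChar₁ q).analyticAt s).meromorphicAt
    refine h1.congr ?_
    have h2 : ∀ᶠ t in nhdsWithin s {s}ᶜ, t ≠ 1 := by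
      rcases eq_or_ne s 1 with rfl | hs
      · exact self_mem_nhdsWithin
      · exact (eventually_ne_nhds hs).filter_mono nhdsWithin_le_nhds
    filter_upwards [h2] with t ht
    rw [DirichletCharacter.LFunctionTrivChar₁, Function.update_of_ne ht,
      inv_mul_cancel_left₀ (sub_ne_zero.mpr ht)]
  · exact ((DirichletCharacter.differentiable_LFunction hχ).analyticAt s).meromorphicAt

lemma meromorphicAt_dirichletL_two_mul {q : ℕ} (hq : 0 < q) (χ : DirichletCharacter ℂ q) (s : ℂ) :
    MeromorphicAt (fun s => dirichletL χ (2 * s)) s :=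
  (meromorphicAt_dirichletL hq χ (2 * s)).comp_analyticAt
    (g := fun s : ℂ => 2 * s) (analyticAt_const.mul analyticAt_id)

lemma meromorphicAt_natCast_cpow {n : ℕ} (hn : 0 < n) (s : ℂ) :
    MeromorphicAt (fun s : ℂ => (n : ℂ) ^ s) s := by
  have hn' : (n : ℂ) ≠ 0 := by exact_mod_cast hn.ne'
  have : Differentiable ℂ fun s : ℂ => (n : ℂ) ^ s := fun s =>
    differentiableAt_id.const_cpow (Or.inl hn')
  exact (this.analyticAt s).meromorphicAt

/-- Meromorphic functions on `ℂ` agreeing on the half-plane `Re s > 1` agree outside a closed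
discrete set. -/
lemma eventuallyEq_codiscrete_of_eq_on_halfPlane {F G : ℂ → ℂ} (hF : MeromorphicOn F Set.univ)
    (hG : MeromorphicOn G Set.univ) (h : ∀ s : ℂ, 1 < s.re → F s = G s) :
    F =ᶠ[Filter.codiscrete ℂ] G := by
  have hFG : MeromorphicOn (F - G) Set.univ := hF.sub hG
  have h2 : meromorphicOrderAt (F - G) 2 = ⊤ := by
    rw [meromorphicOrderAt_eq_top_iff]
    have hopen : IsOpen {s : ℂ | 1 < s.re} := isOpen_lt continuous_const Complex.continuous_re
    refine Filter.Eventually.filter_mono nhdsWithin_le_nhds ?_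
    filter_upwards [hopen.mem_nhds (show (2 : ℂ) ∈ {s : ℂ | 1 < s.re} by simp)] with s hs
    rw [Pi.sub_apply, h s hs, sub_self]
  have hall (x : ℂ) : meromorphicOrderAt (F - G) x = ⊤ := by
    by_contra hx
    exact hFG.meromorphicOrderAt_ne_top_of_isPreconnected isPreconnected_univ
      (Set.mem_univ x) (Set.mem_univ 2) hx h2
  refine mem_codiscrete.mpr fun x => Filter.disjoint_principal_right.mpr ?_
  rw [compl_compl]
  filter_upwards [meromorphicOrderAt_eq_top_iff.mp (hall x)] with s hs
  exact sub_eq_zero.mp hs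

lemma SamePrimitive.apply_neg_one {q₁ q₂ M₁ M₂ N : ℕ} [NeZero M₁] [NeZero M₂] [NeZero N]
    (hM₁ : M₁ ∣ N) (hM₂ : M₂ ∣ N) (h₁ : q₁ ∣ M₁) (h₂ : q₂ ∣ M₂) {χ₁ : DirichletCharacter ℂ q₁}
    {χ₂ : DirichletCharacter ℂ q₂} {ψ : DirichletCharacter ℂ N}
    (h : SamePrimitive (χ₁.mul (star χ₂)) ψ) : χ₁ (-1) * χ₂ (-1) = ψ (-1) := by
  have h := quotientPairs_apply_neg_one
    ((samePrimitive_iff_mem_quotientPairs hM₁ hM₂ h₁ h₂ χ₁ χ₂ ψ).mp h)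
  have hcop (n : ℕ) : IsCoprime (-1 : ℤ) (n : ℤ) := isCoprime_one_left.neg_left
  have e1 := changeLevel_apply_intCast h₁ χ₁ (-1)
  have e2 := changeLevel_apply_intCast h₂ χ₂ (-1)
  rw [if_pos (hcop _)] at e1 e2
  push_cast at e1 e2
  rw [← h, e1, e2]

lemma charCombination_congr {N f : ℕ} {ψ : DirichletCharacter ℂ N} {u : ℤ}
    {E E' : ∀ q₁ q₂ : ℕ, DirichletCharacter ℂ q₁ → DirichletCharacter ℂ q₂ → ℂ → ℂ → ℂ} {z s : ℂ}
    (h : ∀ q₁ ∈ (N / f).divisors, ∀ q₂ ∈ f.divisors, ∀ (χ₁ : DirichletCharacter ℂ q₁)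
      (χ₂ : DirichletCharacter ℂ q₂), χ₁.IsPrimitive ∧ χ₂.IsPrimitive ∧
        SamePrimitive (χ₁.mul (star χ₂)) ψ → ∀ a ∈ f.divisors, ∀ b ∈ (N / f).divisors,
        E q₁ q₂ χ₁ χ₂ (((b * f : ℕ) : ℂ) / ((a * q₂ : ℕ) : ℂ) * z) s =
          E' q₁ q₂ χ₁ χ₂ (((b * f : ℕ) : ℂ) / ((a * q₂ : ℕ) : ℂ) * z) s) :
    charCombination ψ f u E z s = charCombination ψ f u E' z s := by
  rw [charCombination, charCombination]
  congr 1
  refine Finset.sum_congr rfl fun q₁ hq₁ => Finset.sum_congr rfl fun q₂ hq₂ => ?_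
  refine finsum_congr fun χ₁ => finsum_congr fun χ₂ => finsum_congr fun hP => ?_
  congr 1
  refine Finset.sum_congr rfl fun a ha => Finset.sum_congr rfl fun b hb => ?_
  rw [h q₁ hq₁ q₂ hq₂ χ₁ χ₂ hP a (Finset.mem_filter.mp ha).1 b (Finset.mem_filter.mp hb).1]

lemma meromorphicOn_charCombination {N f : ℕ} [NeZero N] (hf : f ∣ N) {ψ : DirichletCharacter ℂ N}
    {u : ℤ} {E : ∀ q₁ q₂ : ℕ, DirichletCharacter ℂ q₁ → DirichletCharacter ℂ q₂ → ℂ → ℂ → ℂ}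
    {z : ℂ}
    (h : ∀ q₁ ∈ (N / f).divisors, ∀ q₂ ∈ f.divisors, ∀ (χ₁ : DirichletCharacter ℂ q₁)
      (χ₂ : DirichletCharacter ℂ q₂), χ₁.IsPrimitive ∧ χ₂.IsPrimitive ∧
        SamePrimitive (χ₁.mul (star χ₂)) ψ → ∀ a ∈ f.divisors, ∀ b ∈ (N / f).divisors,
        MeromorphicOn (E q₁ q₂ χ₁ χ₂ (((b * f : ℕ) : ℂ) / ((a * q₂ : ℕ) : ℂ) * z)) Set.univ) :
    MeromorphicOn (fun s => charCombination ψ f u E z s) Set.univ := by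
  classical
  intro s _
  have hN0 : 0 < N := Nat.pos_of_ne_zero (NeZero.ne N)
  have hf0 : 0 < f := Nat.pos_of_dvd_of_pos hf hN0
  have hM0 : 0 < N / f := Nat.div_pos (Nat.le_of_dvd hN0 hf) hf0
  have hw0 : 0 < N / f / Nat.gcd f (N / f) := Nat.div_pos (Nat.gcd_le_right _ hM0)
    (Nat.gcd_pos_of_pos_left _ hf0)
  have hconst (c : ℂ) : MeromorphicAt (fun _ : ℂ => c) s := MeromorphicAt.const c s
  simp only [charCombination]
  refine (((hconst 1).fun_div (meromorphicAt_natCast_cpow (Nat.mul_pos hf0 hw0) s)).fun_mul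
    (hconst _)).fun_mul (MeromorphicAt.fun_sum fun q₁ hq₁ => MeromorphicAt.fun_sum fun q₂ hq₂ => ?_)
  have hq₁0 := Nat.pos_of_mem_divisors hq₁
  have hq₂0 := Nat.pos_of_mem_divisors hq₂
  have : NeZero q₁ := ⟨hq₁0.ne'⟩
  have : NeZero q₂ := ⟨hq₂0.ne'⟩
  simp only [finsum_pairs_eq_sum]
  refine MeromorphicAt.fun_sum fun χ hχ => ?_
  have hP := (Finset.mem_filter.mp hχ).2
  refine ((hconst _).fun_mul ((meromorphicAt_dirichletL_two_mul (Nat.lcm_pos hq₁0 hq₂0) _ s).fun_div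
    (meromorphicAt_dirichletL_two_mul (Nat.lcm_pos (Nat.lcm_pos hq₁0 hq₂0) hN0) _ s))).fun_mul
    (MeromorphicAt.fun_sum fun a ha => MeromorphicAt.fun_sum fun b hb => ?_)
  have ha' := (Finset.mem_filter.mp ha).1
  have hb' := (Finset.mem_filter.mp hb).1
  exact ((hconst _).fun_div (meromorphicAt_natCast_cpow (Nat.mul_pos
    (Nat.pos_of_mem_divisors ha') (Nat.pos_of_mem_divisors hb')) s)).fun_mul
    (h q₁ hq₁ q₂ hq₂ χ.1 χ.2 hP a ha' b hb' s (Set.mem_univ s))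

end EisensteinCusp

end

theorem mainTheorem1 (N : ℕ) [NeZero N] (k : ℤ) (ψ : DirichletCharacter ℂ N)
    (hψ : ψ (-1) = (-1 : ℂ) ^ k)
    (f : ℕ) (hf : f ∣ N) (u : ℤ) (hu : IsCoprime u (N : ℤ)) (hu0 : u ≠ 0)
    (hsing : EisensteinCusp.IsSingular ψ (((1 / ((u : ℝ) * (f : ℝ)) : ℝ)) : OnePoint ℝ))
    (σ : Matrix.SpecialLinearGroup (Fin 2) ℝ)
    (hσ : EisensteinCusp.IsScalingMatrix N (((1 / ((u : ℝ) * (f : ℝ)) : ℝ)) : OnePoint ℝ) σ)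
    (hσk : Odd k → 0 < σ 0 0) :
    -- the identity in the half-plane of absolute convergence, where all the series converge
    (∀ (z : UpperHalfPlane) (s : ℂ), 1 < s.re →
      Summable (fun x : EisensteinCusp.CuspCosets N
          (((1 / ((u : ℝ) * (f : ℝ)) : ℝ)) : OnePoint ℝ) =>
        EisensteinCusp.cuspTerm ψ k σ z s x.out) ∧
      (∀ (q₁ q₂ : ℕ) (χ₁ : DirichletCharacter ℂ q₁) (χ₂ : DirichletCharacter ℂ q₂),
        0 < q₁ → 0 < q₂ → Summable (EisensteinCusp.charTerm χ₁ χ₂ k (z : ℂ) s)) ∧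
      EisensteinCusp.cuspEisenstein ψ k (((1 / ((u : ℝ) * (f : ℝ)) : ℝ)) : OnePoint ℝ) σ z s =
        EisensteinCusp.charCombination ψ f u
          (fun _ _ χ₁ χ₂ => EisensteinCusp.charEisenstein χ₁ χ₂ k) (z : ℂ) s) ∧
    -- the identity between the meromorphic continuations in `s`
    (∀ (z : UpperHalfPlane) (F : ℂ → ℂ)
      (G : ∀ q₁ q₂ : ℕ, DirichletCharacter ℂ q₁ → DirichletCharacter ℂ q₂ → ℂ → ℂ → ℂ),
      MeromorphicOn F Set.univ →
      (∀ s : ℂ, 1 < s.re → F s = EisensteinCusp.cuspEisenstein ψ k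
        (((1 / ((u : ℝ) * (f : ℝ)) : ℝ)) : OnePoint ℝ) σ z s) →
      (∀ (q₁ q₂ : ℕ) (χ₁ : DirichletCharacter ℂ q₁) (χ₂ : DirichletCharacter ℂ q₂),
        0 < q₁ → 0 < q₂ → χ₁.IsPrimitive → χ₂.IsPrimitive →
        χ₁ (-1) * χ₂ (-1) = (-1 : ℂ) ^ k →
        ∀ w : UpperHalfPlane, MeromorphicOn (G q₁ q₂ χ₁ χ₂ (w : ℂ)) Set.univ ∧
          ∀ s : ℂ, 1 < s.re →
            G q₁ q₂ χ₁ χ₂ (w : ℂ) s = EisensteinCusp.charEisenstein χ₁ χ₂ k (w : ℂ) s) →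
      F =ᶠ[Filter.codiscrete ℂ]
        fun s => EisensteinCusp.charCombination ψ f u G (z : ℂ) s) := by
  have hN0 : 0 < N := Nat.pos_of_ne_zero (NeZero.ne N)
  have hf0 : 0 < f := Nat.pos_of_dvd_of_pos hf hN0
  have hM0 : 0 < N / f := Nat.div_pos (Nat.le_of_dvd hN0 hf) hf0
  have : NeZero f := ⟨hf0.ne'⟩
  have : NeZero (N / f) := ⟨hM0.ne'⟩
  have hN : f * (N / f) = N := Nat.mul_div_cancel' hf
  have hM : N / f ∣ N := Nat.div_dvd_of_dvd hf
  have hmain := fun (z : UpperHalfPlane) (s : ℂ) (hs : 1 < s.re) =>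
    EisensteinCusp.cuspEisenstein_eq_sum_quotientPairs hN hM hf hu hu0 hψ hsing hσ hσk z hs
  have hident : ∀ (z : UpperHalfPlane) (s : ℂ), 1 < s.re →
      EisensteinCusp.cuspEisenstein ψ k (((1 / ((u : ℝ) * (f : ℝ)) : ℝ)) : OnePoint ℝ) σ z s =
        EisensteinCusp.charCombination ψ f u
          (fun _ _ χ₁ χ₂ => EisensteinCusp.charEisenstein χ₁ χ₂ k) (z : ℂ) s := fun z s hs =>
    (hmain z s hs).2.trans (EisensteinCusp.charCombination_eq hf hM hu ψ k z hs).symm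
  refine ⟨fun z s hs => ⟨(hmain z s hs).1, fun q₁ q₂ χ₁ χ₂ _ hq₂ =>
    EisensteinCusp.summable_charTerm χ₁ χ₂ hq₂ k z hs, hident z s hs⟩, ?_⟩
  intro z F G hF hFE hG
  have hG' (q₁ : ℕ) (hq₁ : q₁ ∈ (N / f).divisors) (q₂ : ℕ) (hq₂ : q₂ ∈ f.divisors)
      (χ₁ : DirichletCharacter ℂ q₁) (χ₂ : DirichletCharacter ℂ q₂)
      (hP : χ₁.IsPrimitive ∧ χ₂.IsPrimitive ∧ EisensteinCusp.SamePrimitive (χ₁.mul (star χ₂)) ψ)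
      (a : ℕ) (ha : a ∈ f.divisors) (b : ℕ) (hb : b ∈ (N / f).divisors) :
      MeromorphicOn (G q₁ q₂ χ₁ χ₂ (((b * f : ℕ) : ℂ) / ((a * q₂ : ℕ) : ℂ) * z)) Set.univ ∧
        ∀ s : ℂ, 1 < s.re → G q₁ q₂ χ₁ χ₂ (((b * f : ℕ) : ℂ) / ((a * q₂ : ℕ) : ℂ) * z) s =
          EisensteinCusp.charEisenstein χ₁ χ₂ k (((b * f : ℕ) : ℂ) / ((a * q₂ : ℕ) : ℂ) * z) s := by
    have hb0 := Nat.pos_of_mem_divisors hb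
    have ha0 := Nat.pos_of_mem_divisors ha
    have hq₂0 := Nat.pos_of_mem_divisors hq₂
    have hr : (0 : ℝ) < ((b * f : ℕ) : ℝ) / ((a * q₂ : ℕ) : ℝ) :=
      div_pos (by exact_mod_cast Nat.mul_pos hb0 hf0) (by exact_mod_cast Nat.mul_pos ha0 hq₂0)
    have hw := hG q₁ q₂ χ₁ χ₂ (Nat.pos_of_mem_divisors hq₁) hq₂0 hP.1 hP.2.1
      ((hP.2.2.apply_neg_one hM hf (Nat.dvd_of_mem_divisors hq₁)
        (Nat.dvd_of_mem_divisors hq₂)).trans hψ) (EisensteinCusp.posScale _ hr z)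
    have hcoe : ((EisensteinCusp.posScale _ hr z : UpperHalfPlane) : ℂ) =
        ((b * f : ℕ) : ℂ) / ((a * q₂ : ℕ) : ℂ) * z := by
      simp only [EisensteinCusp.posScale]
      push_cast
      rfl
    rwa [hcoe] at hw
  refine EisensteinCusp.eventuallyEq_codiscrete_of_eq_on_halfPlane hF
    (EisensteinCusp.meromorphicOn_charCombination hf fun q₁ hq₁ q₂ hq₂ χ₁ χ₂ hP a ha b hb =>
      (hG' q₁ hq₁ q₂ hq₂ χ₁ χ₂ hP a ha b hb).1) fun s hs => ?_
  rw [hFE s hs, hident z s hs]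
  exact EisensteinCusp.charCombination_congr fun q₁ hq₁ q₂ hq₂ χ₁ χ₂ hP a ha b hb =>
    ((hG' q₁ hq₁ q₂ hq₂ χ₁ χ₂ hP a ha b hb).2 s hs).symm
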